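/- **Setting.** Consider $L$ cells with $K$ users each and base stations (BSs) with $M\ge 1$ antennas. The channel vector between the $k$-th user of cell $l$ and BS $j$ is $g_{jkl}=\sqrt{\beta_{jkl}}\,h_{jkl}\in\mathbb C^M$, with deterministic $\beta_{jkl}>0$ and $h_{jkl}\sim\mathcal{CN}(0,I_M)$. In the training phase all cells use the same orthonormal training sequences, the rows of $\Phi\in\mathbb C^{K\times K}$ with $\Phi\Phi^{\sf H}=I$, and BS $l$ receives $T_l=\sum_{n}G_{ln}P_n^{1/2}\Phi+Z_l$, where $G_{ln}=[g_{l1n}\dots g_{lKn}]$, $P_n=\mathrm{diag}(p_{1n},\dots,p_{Kn})$, $p_{kn}\ge0$. Let $r_{kl}$ be the $k$-th column of $T_l\Phi^{\sf H}$ and let $\hat g_{lkl}=\mathbb E[g_{lkl}r_{kl}^{\sf H}]\,\mathbb E[r_{kl}r_{kl}^{\sf H}]^{-1}r_{kl}$ be the MMSE channel estimate. In the data phase BS $l$ receives $y_l=\sum_{n}\sum_{m}g_{lmn}\sqrt{q_{mn}}\,s_{mn}+z_l$, $q_{mn}\ge 0$, and matched filtering gives $\tilde s_{kl}=\hat g_{lkl}^{\sf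 H}y_l$. The entries of $Z_l,z_l$ are $\mathcal{CN}(0,1)$, the symbols $s_{mn}$ satisfy $\mathbb E[s_{mn}]=0$, $\mathbb E|s_{mn}|^2=1$, and all fading coefficients, noise entries and symbols are jointly independent. Let $\Omega^{(l)}\ni l$ be the set consisting of cell $l$ and its neighbouring cells, $\tilde s_k^{(l)}=(\tilde s_{kj})_{j\in\Omega^{(l)}}$ and $\beta^{(l)}_{kn}=(\beta_{jkn})_{j\in\Omega^{(l)}}$. Put $$\eta_{kj}=\frac{\beta_{jkj}\sqrt{p_{kj}}}{1+\sum_i\beta_{jki}p_{ki}},\qquad \lambda_{jk}=\Big(1+\sum_i\beta_{jki}p_{ki}\Big)\Big(1+\sum_{n}\sum_{m}\beta_{jmn}q_{mn}\Big),$$ $D_k=\mathrm{diag}(\eta_{kj}:j\in\Omega^{(l)})$, $\Lambda_k^{(l)}=\mathrm{diag}(\lambda_{jk}:j\in\Omega^{(l)})$ and $$C_{kl}=\sum_{n\ne l}\beta^{(l)}_{kn}\beta^{(l){\sf H}}_{kn}p_{kn}q_{kn}M+\Lambda^{(l)}_k,\qquad \hat a_{kl,opt,dec}=C_{kl}^{-1}\beta^{(l)}_{kl}.$$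 For a decoding vector $a\in\mathbb C^{\Omega^{(l)}}$, the estimate $\hat s_{kl,dec}=a^{\sf H}\tilde s_k^{(l)}$ is the sum of the useful signal $U=\sum_{j\in\Omega^{(l)}}a_j^*\,\mathbb E[\hat g_{jkj}^{\sf H}g_{jkl}]\sqrt{q_{kl}}\,s_{kl}$, the pilot contamination $P=\sum_{j\in\Omega^{(l)}}a_j^*\sum_{n\neq l}\mathbb E[\hat g_{jkj}^{\sf H}g_{jkn}]\sqrt{q_{kn}}\,s_{kn}$, and the remaining interference plus noise $I$. Let $$\mathrm{SINR}_{kl,dec}(a)=\frac{\mathbb E|U|^2}{\mathrm{Var}[P]+\mathrm{Var}[I]}.$$ **Theorem.** Fix $k,l$ and assume $p_{kj}>0$ for all $j\in\Omega^{(l)}$ and $q_{kl}>0$. Then $\tilde s_{kj}$ ($j\in\Omega^{(l)}$) and, for every $a$, the three terms $U,P,I$ are square integrable, the matrices $\mathbb E[\tilde s_k^{(l)}\tilde s_k^{(l){\sf H}}]$, $D_k$ and $C_{kl}$ are invertible, $$\mathbb E[\tilde s_k^{(l)}s_{kl}^*]=M\,D_k\,\beta^{(l)}_{kl}\sqrt{q_{kl}}\sqrt{p_{kl}},$$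 which does not require the powers of users outside the cells of $\Omega^{(l)}$ once the $\eta_{kj}$, $j\in\Omega^{(l)}$, are given, and the vector $$a^{\rm MMSE}_{kl}=\mathbb E[\tilde s_k^{(l)}\tilde s_k^{(l){\sf H}}]^{-1}\,\mathbb E[\tilde s_k^{(l)}s_{kl}^*]$$ is nonzero and satisfies $a^{\rm MMSE}_{kl}=c\,D_k^{-1}\hat a_{kl,opt,dec}$ for some real $c>0$. It is SINR-optimal, i.e. $\mathrm{SINR}_{kl,dec}(a)\le\mathrm{SINR}_{kl,dec}(a^{\rm MMSE}_{kl})$ for all $a\ne0$, and $$\mathrm{SINR}_{kl,dec}(a^{\rm MMSE}_{kl})=\mathrm{SINR}_{kl,opt,dec}=p_{kl}q_{kl}M\,\beta^{(l){\sf H}}_{kl}\Big(\sum_{n\neq l}\beta^{(l)}_{kn}\beta^{(l){\sf H}}_{kn}p_{kn}q_{kn}M+\Lambda_k^{(l)}\Big)^{-1}\beta^{(l)}_{kl}.$$ -/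

import Mathlib

open MeasureTheory ProbabilityTheory
open scoped Matrix

noncomputable section

namespace LSFD

/-- The circularly symmetric complex Gaussian law `CN(0,1)`: independent real and imaginary parts,
each with law `N(0, 1/2)`. -/
def complexGaussian : Measure ℂ :=
  ((gaussianReal 0 (1 / 2)).prod (gaussianReal 0 (1 / 2))).map
    Complex.measurableEquivRealProd.symm

/-- The deterministic data of a network with `L` cells and `K` users per cell. -/
structure Network (L K : ℕ) where
  /-- `β j k l`: large scale fading coefficient between the `k`-th user of cell `l` and the
  base station of cell `j`. -/
  β : Fin L → Fin K → Fin L → ℝ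
  /-- `p k l`: training power of the `k`-th user of cell `l`. -/
  p : Fin K → Fin L → ℝ
  /-- `q k l`: data transmission power of the `k`-th user of cell `l`. -/
  q : Fin K → Fin L → ℝ
  /-- The rows of `Φ` are the training sequences. -/
  Φ : Matrix (Fin K) (Fin K) ℂ
  /-- `nbhd l`: the cell `l` together with its neighbouring cells. -/
  nbhd : Fin L → Finset (Fin L)

/-- The random quantities of one coherence interval, with `M` antennas at each base station. -/
structure Signals (L K M : ℕ) (Ω : Type*) where
  /-- Small scale fading: `h j k l m` belongs to the `k`-th user of cell `l` and the `m`-th antenna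
  of base station `j`. -/
  h : Fin L → Fin K → Fin L → Fin M → Ω → ℂ
  /-- Training noise: `Z l m i` is the noise at antenna `m` of base station `l` in the `i`-th
  training slot. -/
  Z : Fin L → Fin M → Fin K → Ω → ℂ
  /-- Noise during data transmission, at antenna `m` of base station `l`. -/
  z : Fin L → Fin M → Ω → ℂ
  /-- Data symbol of the `k`-th user of cell `l`. -/
  s : Fin K → Fin L → Ω → ℂ

variable {L K M : ℕ} {Ω : Type*}

/-- All sources of randomness as one family of complex random variables. -/
def Signals.source (S : Signals L K M Ω) :
    (Fin L × Fin K × Fin L × Fin M) ⊕ (Fin L × Fin M × Fin K) ⊕ (Fin L × Fin M) ⊕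
      (Fin K × Fin L) → Ω → ℂ
  | .inl (j, k, l, m) => S.h j k l m
  | .inr (.inl (l, m, i)) => S.Z l m i
  | .inr (.inr (.inl (l, m))) => S.z l m
  | .inr (.inr (.inr (k, l))) => S.s k l

/-- The probabilistic assumptions: fading coefficients and noises have law `CN(0,1)`, the data
symbols are centred with unit power (and an otherwise arbitrary law), and all of these random
variables are independent. -/
structure Signals.IsModel [MeasurableSpace Ω] (S : Signals L K M Ω) (μ : Measure Ω) : Prop where
  measurable : ∀ i, Measurable (S.source i)
  indep : iIndepFun S.source μ
  law_h : ∀ j k l m, μ.map (S.h j k l m) = complexGaussian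
  law_Z : ∀ l m i, μ.map (S.Z l m i) = complexGaussian
  law_z : ∀ l m, μ.map (S.z l m) = complexGaussian
  memLp_s : ∀ k l, MemLp (S.s k l) 2 μ
  mean_s : ∀ k l, ∫ ω, S.s k l ω ∂μ = 0
  power_s : ∀ k l, ∫ ω, ‖S.s k l ω‖ ^ 2 ∂μ = 1

/-- `E[u vᴴ]` for random vectors `u`, `v`. -/
def corr [MeasurableSpace Ω] (μ : Measure Ω) {ι κ : Type*} (u : Ω → ι → ℂ) (v : Ω → κ → ℂ) :
    Matrix ι κ ℂ :=
  Matrix.of fun i j => ∫ ω, u ω i * star (v ω j) ∂μ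

/-- Variance of a complex random variable. -/
def cvar [MeasurableSpace Ω] (μ : Measure Ω) (X : Ω → ℂ) : ℝ :=
  ∫ ω, ‖X ω - ∫ ω', X ω' ∂μ‖ ^ 2 ∂μ

variable (N : Network L K) (S : Signals L K M Ω)

/-- Channel vector between the `k`-th user of cell `l` and base station `j`. -/
def g (j : Fin L) (k : Fin K) (l : Fin L) (ω : Ω) : Fin M → ℂ :=
  fun m => (√(N.β j k l) : ℂ) * S.h j k l m ω

/-- Signal received by base station `l` during training,
`T_l = ∑ₙ G_{ln} P_n^{1/2} Φ + Z_l`. -/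
def trainingSignal (l : Fin L) (ω : Ω) : Matrix (Fin M) (Fin K) ℂ :=
  ∑ n, (Matrix.of fun m k => g N S l k n ω m) *
      Matrix.diagonal (fun k => (√(N.p k n) : ℂ)) * N.Φ
    + Matrix.of fun m i => S.Z l m i ω

/-- `r_{kl}`: the `k`-th column of `T_l Φᴴ`. -/
def r (k : Fin K) (l : Fin L) (ω : Ω) : Fin M → ℂ :=
  fun m => (trainingSignal N S l ω * N.Φᴴ) m k

/-- Signal received by base station `l` during data transmission. -/
def y (l : Fin L) (ω : Ω) : Fin M → ℂ :=
  fun a => ∑ n, ∑ m, g N S l m n ω a * (√(N.q m n) : ℂ) * S.s m n ω + S.z l a ω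

/-- `η_{kj} = β_{jkj} √p_{kj} / (1 + ∑ᵢ β_{jki} p_{ki})`. -/
def eta (k : Fin K) (j : Fin L) : ℝ :=
  N.β j k j * √(N.p k j) / (1 + ∑ i, N.β j k i * N.p k i)

/-- `λ_{jk}`. -/
def lam (j : Fin L) (k : Fin K) : ℝ :=
  (1 + ∑ i, N.β j k i * N.p k i) * (1 + ∑ n, ∑ m, N.β j m n * N.q m n)

/-- `β_{kn}^{(l)}`: the vector of the `β_{jkn}`, `j` in the neighbourhood of `l`. -/
def betaVec (l : Fin L) (k : Fin K) (n : Fin L) : N.nbhd l → ℝ :=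
  fun j => N.β j k n

/-- `D_k`, the diagonal matrix of the `η_{kj}`, `j` in the neighbourhood of `l`. -/
def Dmat (k : Fin K) (l : Fin L) : Matrix (N.nbhd l) (N.nbhd l) ℝ :=
  Matrix.diagonal fun j => eta N k j

/-- `∑_{n ≠ l} β_{kn}^{(l)} β_{kn}^{(l)ᴴ} p_{kn} q_{kn} M + Λ_k^{(l)}` (the vectors are real). -/
def Cmat (M : ℕ) (N : Network L K) (k : Fin K) (l : Fin L) : Matrix (N.nbhd l) (N.nbhd l) ℝ :=
  ∑ n ∈ Finset.univ.erase l,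
      (N.p k n * N.q k n * (M : ℝ)) • Matrix.vecMulVec (betaVec N l k n) (betaVec N l k n)
    + Matrix.diagonal fun j : N.nbhd l => lam N j k

/-- `â_{kl,opt,dec}`. -/
def aHatOpt (M : ℕ) (N : Network L K) (k : Fin K) (l : Fin L) : N.nbhd l → ℝ :=
  (Cmat M N k l)⁻¹ *ᵥ betaVec N l k l

/-- `SINR_{kl,opt,dec}`. -/
def sinrOpt (M : ℕ) (N : Network L K) (k : Fin K) (l : Fin L) : ℝ :=
  N.p k l * N.q k l * (M : ℝ) * (betaVec N l k l ⬝ᵥ (Cmat M N k l)⁻¹ *ᵥ betaVec N l k l)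

variable [MeasurableSpace Ω] (μ : Measure Ω)

/-- The MMSE estimate of `g_{jkj}` from the training signal,
`ĝ_{jkj} = E[g_{jkj} r_{kj}ᴴ] E[r_{kj} r_{kj}ᴴ]⁻¹ r_{kj}`. -/
def gHat (j : Fin L) (k : Fin K) (ω : Ω) : Fin M → ℂ :=
  (corr μ (g N S j k j) (r N S k j) * (corr μ (r N S k j) (r N S k j))⁻¹) *ᵥ r N S k j ω

/-- Matched filter output `s̃_{kj} = ĝ_{jkj}ᴴ y_j`. -/
def sTilde (k : Fin K) (j : Fin L) (ω : Ω) : ℂ :=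
  star (gHat N S μ j k ω) ⬝ᵥ y N S j ω

/-- `s̃_k^{(l)}`, the vector of matched filter outputs collected by base station `l`. -/
def sTildeVec (k : Fin K) (l : Fin L) (ω : Ω) : N.nbhd l → ℂ :=
  fun j => sTilde N S μ k j ω

/-- The decentralized estimate `ŝ_{kl,dec} = aᴴ s̃_k^{(l)}`. -/
def sHatDec (k : Fin K) (l : Fin L) (a : N.nbhd l → ℂ) (ω : Ω) : ℂ :=
  star a ⬝ᵥ sTildeVec N S μ k l ω

/-- The effective gain `ĝ_{jkj}ᴴ g_{jmn}`. -/
def gain (j : Fin L) (k : Fin K) (m : Fin K) (n : Fin L) (ω : Ω) : ℂ :=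
  star (gHat N S μ j k ω) ⬝ᵥ g N S j m n ω

/-- `E[ĝ_{jkj}ᴴ g_{jkn}]`. -/
def meanGain (j : Fin L) (k : Fin K) (n : Fin L) : ℂ :=
  ∫ ω, gain N S μ j k k n ω ∂μ

/-- The useful signal in `ŝ_{kl,dec}`. -/
def usefulSignal (k : Fin K) (l : Fin L) (a : N.nbhd l → ℂ) (ω : Ω) : ℂ :=
  ∑ j, star (a j) * meanGain N S μ j k l * (√(N.q k l) : ℂ) * S.s k l ω

/-- The pilot contamination in `ŝ_{kl,dec}`. -/
def pilotContamination (k : Fin K) (l : Fin L) (a : N.nbhd l → ℂ) (ω : Ω) : ℂ :=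
  ∑ j, star (a j) * ∑ n ∈ Finset.univ.erase l,
    meanGain N S μ j k n * (√(N.q k n) : ℂ) * S.s k n ω

/-- The interference plus noise terms in `ŝ_{kl,dec}`. -/
def interferenceNoise (k : Fin K) (l : Fin L) (a : N.nbhd l → ℂ) (ω : Ω) : ℂ :=
  ∑ n, ∑ j, star (a j) * (gain N S μ j k k n ω - meanGain N S μ j k n) *
      (√(N.q k n) : ℂ) * S.s k n ω
    + ∑ n, ∑ m ∈ Finset.univ.erase k, ∑ j, star (a j) * gain N S μ j k m n ω *
      (√(N.q m n) : ℂ) * S.s m n ω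
    + ∑ j : N.nbhd l, star (a j) * (star (gHat N S μ j k ω) ⬝ᵥ fun m => S.z j m ω)

/-- The three terms add up to the decentralized estimate. -/
theorem sHatDec_eq (k : Fin K) (l : Fin L) (a : N.nbhd l → ℂ) (ω : Ω) :
    sHatDec N S μ k l a ω = usefulSignal N S μ k l a ω + pilotContamination N S μ k l a ω
      + interferenceNoise N S μ k l a ω := by
  have hs : ∀ j : N.nbhd l, sTilde N S μ k j ω =
      (meanGain N S μ j k l * (√(N.q k l) : ℂ) * S.s k l ω
        + ∑ n ∈ Finset.univ.erase l, meanGain N S μ j k n * (√(N.q k n) : ℂ) * S.s k n ω)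
      + (∑ n, (gain N S μ j k k n ω - meanGain N S μ j k n) * (√(N.q k n) : ℂ) * S.s k n ω
        + ∑ n, ∑ m ∈ Finset.univ.erase k, gain N S μ j k m n ω * (√(N.q m n) : ℂ) * S.s m n ω
        + (star (gHat N S μ j k ω) ⬝ᵥ fun m => S.z j m ω)) := by
    intro j
    have h1 : sTilde N S μ k j ω =
        ∑ n, ∑ m, gain N S μ j k m n ω * (√(N.q m n) : ℂ) * S.s m n ω
          + (star (gHat N S μ j k ω) ⬝ᵥ fun m => S.z j m ω) := by
      simp only [sTilde, gain, y, dotProduct, mul_add, Finset.sum_add_distrib, Finset.mul_sum,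
        Finset.sum_mul]
      congr 1
      rw [Finset.sum_comm]
      refine Finset.sum_congr rfl fun n _ => ?_
      rw [Finset.sum_comm]
      refine Finset.sum_congr rfl fun m _ => Finset.sum_congr rfl fun i _ => by ring
    rw [h1, Finset.add_sum_erase Finset.univ
      (fun n => meanGain N S μ j k n * (√(N.q k n) : ℂ) * S.s k n ω) (Finset.mem_univ l),
      ← add_assoc, ← add_assoc, ← Finset.sum_add_distrib, ← Finset.sum_add_distrib]
    congr 1
    refine Finset.sum_congr rfl fun n _ => ?_
    rw [← Finset.add_sum_erase Finset.univ
      (fun m => gain N S μ j k m n ω * (√(N.q m n) : ℂ) * S.s m n ω) (Finset.mem_univ k)]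
    ring
  simp only [sHatDec, sTildeVec, dotProduct, Pi.star_apply] at hs ⊢
  simp only [hs, usefulSignal, pilotContamination, interferenceNoise, mul_add,
    Finset.sum_add_distrib, dotProduct, Finset.mul_sum, ← mul_assoc, Pi.star_apply]
  have e1 := Finset.sum_comm (s := (Finset.univ : Finset (Fin L)))
    (t := (Finset.univ : Finset (N.nbhd l)))
    (f := fun n j => star (a j) * (gain N S μ j k k n ω - meanGain N S μ j k n) *
      (√(N.q k n) : ℂ) * S.s k n ω)
  have e2 : ∑ n, ∑ m ∈ Finset.univ.erase k, ∑ j : N.nbhd l, star (a j) * gain N S μ j k m n ω *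
      (√(N.q m n) : ℂ) * S.s m n ω = ∑ j : N.nbhd l, ∑ n, ∑ m ∈ Finset.univ.erase k,
        star (a j) * gain N S μ j k m n ω * (√(N.q m n) : ℂ) * S.s m n ω := by
    rw [Finset.sum_comm' (s := (Finset.univ : Finset (N.nbhd l)))
      (t := fun _ => (Finset.univ : Finset (Fin L)))
      (t' := Finset.univ) (s' := fun _ => Finset.univ) (by simp)]
    exact Finset.sum_congr rfl fun n _ => Finset.sum_comm
  rw [e1, e2]

/-- `SINR_{kl,dec}` of a decoding vector `a`: power of the useful signal over the variances of
the pilot contamination and of the interference plus noise. -/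
def sinrDec (k : Fin K) (l : Fin L) (a : N.nbhd l → ℂ) : ℝ :=
  (∫ ω, ‖usefulSignal N S μ k l a ω‖ ^ 2 ∂μ) /
    (cvar μ (pilotContamination N S μ k l a) + cvar μ (interferenceNoise N S μ k l a))

/-- `E[s̃_k^{(l)} s̃_k^{(l)ᴴ}]`. -/
def covMat (k : Fin K) (l : Fin L) : Matrix (N.nbhd l) (N.nbhd l) ℂ :=
  corr μ (sTildeVec N S μ k l) (sTildeVec N S μ k l)

/-- `E[s̃_k^{(l)} s_{kl}^*]`. -/
def crossVec (k : Fin K) (l : Fin L) : N.nbhd l → ℂ :=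
  fun j => ∫ ω, sTildeVec N S μ k l ω j * star (S.s k l ω) ∂μ

/-- `a_{kl}^{MMSE} = E[s̃_k^{(l)} s̃_k^{(l)ᴴ}]⁻¹ E[s̃_k^{(l)} s_{kl}^*]`. -/
def aMMSE (k : Fin K) (l : Fin L) : N.nbhd l → ℂ :=
  (covMat N S μ k l)⁻¹ *ᵥ crossVec N S μ k l

end LSFD

end

noncomputable section

namespace LSFD

open scoped NNReal

/-! ### Moments of the complex Gaussian law -/

/-! Correlating with the orthonormal pilots turns each entry of `r_{kj}` into a linear combination
`∑ᵢ wᵢ eᵢ` of independent sources seen at one antenna, with `‖w‖² = 1 + ∑ᵢ β_{jki} p_{ki}`;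
different antennas see disjoint sets of sources. Both correlation matrices in the MMSE estimate are
therefore scalar, and `ĝ_{jkj} = η_{kj} r_{kj}` (`gHat_eq`). Each filter output splits into the
pilot-sharing symbols, weighted by mean gains, and `localNoise`: a weighted sum, over antennas and
over data symbols (receiver noise counting as the symbol `1`), of a symbol times a fluctuation
`conj(∑ᵢ wᵢ eᵢ) e - conj w_e`.

The crux is `IsWhite.memLp_and_integral_centredProd`: such a fluctuation has variance `‖w‖²` however
strongly `e` itself enters `r`, because a `CN(0,1)` variable has fourth moment `2` and hence `Var
|e|² = 1`. Users sharing the pilot are thus no exception, and since the products of symbols and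
fluctuations are mutually uncorrelated, the variance of `localNoise` factorises as `M η² λ` and is
uncorrelated between base stations and with the symbols.

Put `b = D a`, `β = β_{kl}^{(l)}`, `w = p_{kl} q_{kl} M`. Then the SINR is `w |bᴴβ|² / bᴴCb`, the
covariance matrix is `M D (C + w ββᵀ) D`, and the cross-correlation is `M √(pq) Dβ`. Cauchy–Schwarz
for the form of `C` (`norm_sq_le_gramDiagForm_mul`) bounds the SINR by `w βᵀC⁻¹β`, with equality at
multiples of `C⁻¹β`. Since `(C + w ββᵀ) C⁻¹β = (1 + w βᵀC⁻¹β) β`, the MMSE vector is a positive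
multiple of `D⁻¹C⁻¹β`, so it attains the bound. -/

theorem integral_sq_gaussianReal (v : ℝ≥0) : ∫ x, x ^ 2 ∂gaussianReal 0 v = v := by
  have h := variance_fun_id_gaussianReal (μ := 0) (v := v)
  rw [variance_of_integral_eq_zero aemeasurable_id' integral_id_gaussianReal] at h
  exact h

/-- The fourth moment is the fourth derivative at `0` of the moment generating function `exp (v t² /
2)`. -/
theorem integral_pow_four_gaussianReal (v : ℝ≥0) :
    ∫ x, x ^ 4 ∂gaussianReal 0 v = 3 * (v : ℝ) ^ 2 := by
  have h := iteratedDeriv_mgf_zero (X := id) (μ := gaussianReal 0 v)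
    (by simp [integrableExpSet_id_gaussianReal]) 4
  have e : ∫ x, x ^ 4 ∂gaussianReal 0 v = (gaussianReal 0 v)[id ^ 4] := rfl
  rw [e, ← h, mgf_id_gaussianReal]
  set w : ℝ := (v : ℝ)
  have d0 : ∀ t : ℝ, HasDerivAt (fun t => Real.exp (0 * t + w * t ^ 2 / 2))
      (w * t * Real.exp (0 * t + w * t ^ 2 / 2)) t := fun t => by
    have := ((((hasDerivAt_id t).const_mul 0).add
      ((((hasDerivAt_id t).pow 2).const_mul w).div_const 2))).exp
    convert! this using 1
    simp; ring
  -- Differentiation preserves the shape "polynomial times the exponential", so this single rule can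
  -- be iterated.
  have d (P : ℝ → ℝ) (P' : ℝ → ℝ) (hP : ∀ t, HasDerivAt P (P' t) t) :
      deriv (fun t => P t * Real.exp (0 * t + w * t ^ 2 / 2)) =
        fun t => (P' t + P t * (w * t)) * Real.exp (0 * t + w * t ^ 2 / 2) := by
    funext t
    rw [((hP t).fun_mul (d0 t)).deriv]
    ring
  have d1 : deriv (fun t => Real.exp (0 * t + w * t ^ 2 / 2)) =
      fun t => (w * t) * Real.exp (0 * t + w * t ^ 2 / 2) := funext fun t => (d0 t).deriv
  have hid (t : ℝ) := hasDerivAt_id' t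
  rw [iteratedDeriv_succ, iteratedDeriv_succ, iteratedDeriv_succ, iteratedDeriv_one, d1,
    d _ (fun _ => w * 1) (fun t => (hid t).const_mul w),
    d _ (fun t => 0 + ((w * 1) * (w * t) + (w * t) * (w * 1)))
      (fun t => (hasDerivAt_const t _).fun_add
        (((hid t).const_mul w).fun_mul ((hid t).const_mul w))),
    d _ (fun t => 0 + (((w * 1) * (w * 1)) + ((w * 1) * (w * 1))) +
        ((0 + ((w * 1) * (w * t) + (w * t) * (w * 1))) * (w * t) +
          (w * 1 + w * t * (w * t)) * (w * 1)))]
  · simp; ring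
  · intro t
    have a := (hid t).const_mul w
    exact ((hasDerivAt_const t (0 : ℝ)).fun_add ((a.const_mul (w * 1)).fun_add
      (a.mul_const (w * 1)))).fun_add
        (((hasDerivAt_const t (w * 1)).fun_add (a.fun_mul a)).fun_mul a)

theorem integrable_pow_gaussianReal (n : ℕ) (v : ℝ≥0) :
    Integrable (fun x : ℝ => x ^ n) (gaussianReal 0 v) := by
  have h := (memLp_id_gaussianReal (μ := 0) (v := v) n)
  have := h.integrable_norm_pow'
  refine (integrable_norm_iff (by fun_prop)).1 (this.congr (ae_of_all _ fun x => ?_))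
  simp

instance : IsProbabilityMeasure complexGaussian :=
  Measure.isProbabilityMeasure_map (by fun_prop)

theorem integral_complexGaussian {E : Type*} [NormedAddCommGroup E] [NormedSpace ℝ E]
    (f : ℂ → E) :
    ∫ z, f z ∂complexGaussian =
      ∫ x, f ⟨x.1, x.2⟩ ∂(gaussianReal 0 (1 / 2)).prod (gaussianReal 0 (1 / 2)) :=
  integral_map_equiv _ _

theorem integrable_complexGaussian_iff {E : Type*} [NormedAddCommGroup E] [NormedSpace ℝ E]
    (f : ℂ → E) : Integrable f complexGaussian ↔
      Integrable (fun x : ℝ × ℝ => f ⟨x.1, x.2⟩)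
        ((gaussianReal 0 (1 / 2)).prod (gaussianReal 0 (1 / 2))) :=
  integrable_map_equiv _ _

theorem integrable_mul_pow_gaussianReal (m n : ℕ) : Integrable (fun x : ℝ × ℝ => x.1 ^ m * x.2 ^ n)
    ((gaussianReal 0 (1 / 2)).prod (gaussianReal 0 (1 / 2))) :=
  (integrable_pow_gaussianReal m _).mul_prod (integrable_pow_gaussianReal n _)

theorem norm_sq_mk (x y : ℝ) : ‖(⟨x, y⟩ : ℂ)‖ ^ 2 = x ^ 2 + y ^ 2 := by
  rw [← Complex.normSq_eq_norm_sq, Complex.normSq_mk]; ring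

theorem integrable_norm_pow_four_complexGaussian :
    Integrable (fun z : ℂ => ‖z‖ ^ 4) complexGaussian := by
  rw [integrable_complexGaussian_iff]
  refine (((integrable_mul_pow_gaussianReal 4 0).add
    ((integrable_mul_pow_gaussianReal 2 2).const_mul 2)).add
      (integrable_mul_pow_gaussianReal 0 4)).congr (ae_of_all _ fun x => ?_)
  have : ‖(⟨x.1, x.2⟩ : ℂ)‖ ^ 4 = (x.1 ^ 2 + x.2 ^ 2) ^ 2 := by rw [← norm_sq_mk]; ring
  simp only [this, Pi.add_apply]; ring

/-- With variance `1/2` in each coordinate, `E (x² + y²)² = 3/4 + 2 · 1/4 + 3/4`. The consequence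
that matters is `Var |z|² = 2 - 1 = 1`. -/
theorem integral_norm_pow_four_complexGaussian : ∫ z, ‖z‖ ^ 4 ∂complexGaussian = 2 := by
  rw [integral_complexGaussian]
  have : ∀ x : ℝ × ℝ, ‖(⟨x.1, x.2⟩ : ℂ)‖ ^ 4 =
      x.1 ^ 4 * x.2 ^ 0 + 2 * (x.1 ^ 2 * x.2 ^ 2) + x.1 ^ 0 * x.2 ^ 4 := fun x => by
    have : ‖(⟨x.1, x.2⟩ : ℂ)‖ ^ 4 = (x.1 ^ 2 + x.2 ^ 2) ^ 2 := by rw [← norm_sq_mk]; ring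
    rw [this]; ring
  simp only [this]
  rw [integral_add (f := fun x : ℝ × ℝ => x.1 ^ 4 * x.2 ^ 0 + 2 * (x.1 ^ 2 * x.2 ^ 2))
    ((integrable_mul_pow_gaussianReal 4 0).add
      ((integrable_mul_pow_gaussianReal 2 2).const_mul 2)) (integrable_mul_pow_gaussianReal 0 4),
    integral_add (integrable_mul_pow_gaussianReal 4 0)
      ((integrable_mul_pow_gaussianReal 2 2).const_mul 2), integral_const_mul,
    integral_prod_mul (fun x : ℝ => x ^ 4) (fun x : ℝ => x ^ 0),
    integral_prod_mul (fun x : ℝ => x ^ 2) (fun x : ℝ => x ^ 2),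
    integral_prod_mul (fun x : ℝ => x ^ 0) (fun x : ℝ => x ^ 4)]
  simp only [integral_sq_gaussianReal, integral_pow_four_gaussianReal, pow_zero]
  simp; norm_num

theorem integral_norm_sq_complexGaussian : ∫ z, ‖z‖ ^ 2 ∂complexGaussian = 1 := by
  rw [integral_complexGaussian]
  have : ∀ x : ℝ × ℝ, ‖(⟨x.1, x.2⟩ : ℂ)‖ ^ 2 = x.1 ^ 2 * x.2 ^ 0 + x.1 ^ 0 * x.2 ^ 2 := fun x => by
    rw [norm_sq_mk]; ring
  simp only [this]
  rw [integral_add (integrable_mul_pow_gaussianReal 2 0) (integrable_mul_pow_gaussianReal 0 2),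
    integral_prod_mul (fun x : ℝ => x ^ 2) (fun x : ℝ => x ^ 0),
    integral_prod_mul (fun x : ℝ => x ^ 0) (fun x : ℝ => x ^ 2)]
  simp only [integral_sq_gaussianReal, pow_zero]
  simp; norm_num

theorem memLp_id_complexGaussian : MemLp (fun z : ℂ => z) 4 complexGaussian := by
  rw [← integrable_norm_rpow_iff (by fun_prop) (by simp) (by simp)]
  refine integrable_norm_pow_four_complexGaussian.congr (ae_of_all _ fun z => ?_)
  have h4 : (4 : ENNReal).toReal = ((4 : ℕ) : ℝ) := by simp
  simp only [h4]
  exact (Real.rpow_natCast ‖z‖ 4).symm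

theorem integral_id_complexGaussian : ∫ z, z ∂complexGaussian = 0 := by
  have hi : Integrable (fun z : ℂ => z) complexGaussian :=
    memLp_id_complexGaussian.integrable (by norm_num)
  apply Complex.ext
  · have := (Complex.reCLM.integral_comp_comm hi)
    simp only [Complex.reCLM_apply] at this
    rw [← this, integral_complexGaussian]
    have := integral_prod_mul (μ := gaussianReal 0 (1 / 2)) (ν := gaussianReal 0 (1 / 2))
      (fun x : ℝ => x) (fun _ : ℝ => (1 : ℝ))
    simpa using this
  · have := (Complex.imCLM.integral_comp_comm hi)
    simp only [Complex.imCLM_apply] at this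
    rw [← this, integral_complexGaussian]
    have := integral_prod_mul (μ := gaussianReal 0 (1 / 2)) (ν := gaussianReal 0 (1 / 2))
      (fun _ : ℝ => (1 : ℝ)) (fun x : ℝ => x)
    simpa using this

/-! ### Second moments of complex random variables -/

section
variable {Ω : Type*} [MeasurableSpace Ω] {μ : Measure Ω}

theorem integrable_mul_star {f g : Ω → ℂ} (hf : MemLp f 2 μ) (hg : MemLp g 2 μ) :
    Integrable (fun ω => f ω * star (g ω)) μ :=
  hf.integrable_mul hg.star

theorem integral_norm_sq_eq (f : Ω → ℂ) :
    ((∫ ω, ‖f ω‖ ^ 2 ∂μ : ℝ) : ℂ) = ∫ ω, f ω * star (f ω) ∂μ := by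
  rw [← integral_complex_ofReal]
  congr 1; funext ω
  simp [Complex.mul_conj, Complex.normSq_eq_norm_sq]

theorem memLp_finset_sum_const_mul {ι : Type*} (s : Finset ι) (c : ι → ℂ) {f : ι → Ω → ℂ}
    (hf : ∀ i ∈ s, MemLp (f i) 2 μ) : MemLp (fun ω => ∑ i ∈ s, c i * f i ω) 2 μ :=
  memLp_finsetSum _ fun i hi => (hf i hi).const_mul (c i)

theorem integral_sum_mul_star_sum {ι κ : Type*} (s : Finset ι) (t : Finset κ) (c : ι → ℂ)
    (d : κ → ℂ) {f : ι → Ω → ℂ} {g : κ → Ω → ℂ} (hf : ∀ i ∈ s, MemLp (f i) 2 μ)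
    (hg : ∀ i ∈ t, MemLp (g i) 2 μ) :
    ∫ ω, (∑ i ∈ s, c i * f i ω) * star (∑ i ∈ t, d i * g i ω) ∂μ =
      ∑ i ∈ s, ∑ i' ∈ t, c i * star (d i') * ∫ ω, f i ω * star (g i' ω) ∂μ := by
  have : ∀ ω, (∑ i ∈ s, c i * f i ω) * star (∑ i ∈ t, d i * g i ω) =
      ∑ i ∈ s, ∑ i' ∈ t, c i * star (d i') * (f i ω * star (g i' ω)) := fun ω => by
    rw [star_sum, Finset.sum_mul_sum]
    refine Finset.sum_congr rfl fun i _ => Finset.sum_congr rfl fun i' _ => ?_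
    rw [star_mul']; ring
  simp only [this]
  rw [integral_finsetSum _ fun i hi => integrable_finsetSum _ fun i' hi' =>
    (integrable_mul_star (hf i hi) (hg i' hi')).const_mul _]
  refine Finset.sum_congr rfl fun i hi => ?_
  rw [integral_finsetSum _ fun i' hi' =>
    (integrable_mul_star (hf i hi) (hg i' hi')).const_mul _]
  exact Finset.sum_congr rfl fun i' _ => integral_const_mul _ _

/-- Independence passes to the squared norms, whose product is then integrable; no fourth moments
are needed. In particular the data symbols may have any law with finite variance. -/
theorem memLp_mul_of_indepFun {f g : Ω → ℂ} (hfg : IndepFun f g μ) (hf : MemLp f 2 μ)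
    (hg : MemLp g 2 μ) : MemLp (fun ω => f ω * g ω) 2 μ := by
  rw [memLp_two_iff_integrable_sq_norm (f := fun ω => f ω * g ω) (hf.1.mul hg.1)]
  have h := (hfg.comp (φ := fun z : ℂ => ‖z‖ ^ 2) (ψ := fun z : ℂ => ‖z‖ ^ 2) (by fun_prop)
    (by fun_prop)).integrable_mul ((memLp_two_iff_integrable_sq_norm hf.1).1 hf)
    ((memLp_two_iff_integrable_sq_norm hg.1).1 hg)
  refine h.congr (ae_of_all _ fun ω => ?_)
  simp [mul_pow]

theorem integral_mul_of_indepFun {f g : Ω → ℂ} (hfg : IndepFun f g μ) (hf : Measurable f)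
    (hg : Measurable g) : ∫ ω, f ω * g ω ∂μ = (∫ ω, f ω ∂μ) * ∫ ω, g ω ∂μ :=
  hfg.integral_fun_mul_eq_mul_integral hf.aestronglyMeasurable hg.aestronglyMeasurable

end

/-! ### Independent standardized families -/

section White
variable {Ω : Type*} {ι : Type*} {e : ι → Ω → ℂ}

theorem measurable_star_comp {α : Type*} {m : MeasurableSpace α} {f : α → ℂ}
    (hf : Measurable[m] f) : Measurable[m] (fun ω => star (f ω)) :=
  continuous_star.measurable.comp hf

theorem measurable_mul_star_comp {α : Type*} {m : MeasurableSpace α} {f g : α → ℂ}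
    (hf : Measurable[m] f) (hg : Measurable[m] g) :
    Measurable[m] (fun ω => f ω * star (g ω)) :=
  hf.mul (measurable_star_comp hg)

/-- The σ-algebra generated by the members of `e` with index in `T`. -/
@[reducible]
def sigmaGen (e : ι → Ω → ℂ) (T : Set ι) : MeasurableSpace Ω :=
  ⨆ i ∈ T, MeasurableSpace.comap (e i) inferInstance

theorem measurable_sigmaGen {T : Set ι} {i : ι} (hi : i ∈ T) : Measurable[sigmaGen e T] (e i) :=
  Measurable.mono (comap_measurable (e i))
    (le_iSup₂_of_le (f := fun i (_ : i ∈ T) => MeasurableSpace.comap (e i) inferInstance) i hi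
      le_rfl)
    le_rfl

variable (e) in
/-- The centred product of the conjugate of `∑ᵢ wᵢ eᵢ` with `e i₀`. -/
def centredProd [Fintype ι] (w : ι → ℂ) (i₀ : ι) (ω : Ω) : ℂ :=
  star (∑ i, w i * e i ω) * e i₀ ω - star (w i₀)

/-- Separating the term `i₀` of the sum leaves a function of `e i₀` alone and a product of `e i₀`
with a factor independent of it. These two parts turn out to be orthogonal. -/
theorem centredProd_eq [Fintype ι] [DecidableEq ι] (w : ι → ℂ) (i₀ : ι) (ω : Ω) :
    centredProd e w i₀ ω = star (w i₀) * ((‖e i₀ ω‖ : ℂ) ^ 2 - 1)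
      + e i₀ ω * star (∑ i, (Function.update w i₀ 0) i * e i ω) := by
  have h1 : ∑ i, w i * e i ω = w i₀ * e i₀ ω + ∑ i, (Function.update w i₀ 0) i * e i ω := by
    rw [← Finset.add_sum_erase _ _ (Finset.mem_univ i₀),
      ← Finset.add_sum_erase _ (fun i => (Function.update w i₀ 0) i * e i ω) (Finset.mem_univ i₀)]
    simp only [Function.update_self, zero_mul, zero_add]
    congr 1
    exact Finset.sum_congr rfl fun i hi => by rw [Function.update_of_ne (Finset.ne_of_mem_erase hi)]
  rw [centredProd, h1, ← Complex.mul_conj']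
  simp only [star_add, star_mul', RCLike.star_def]
  ring

theorem measurable_sum [Fintype ι] {T : Set ι} {w : ι → ℂ} (hw : ∀ i, i ∉ T → w i = 0) :
    Measurable[sigmaGen e T] (fun ω => ∑ i, w i * e i ω) := by
  refine Finset.measurable_fun_sum _ fun i _ => ?_
  by_cases hi : i ∈ T
  · exact (measurable_sigmaGen hi).const_mul _
  · simp only [hw i hi, zero_mul]
    exact measurable_const

theorem measurable_centredProd [Fintype ι] {T : Set ι} {w : ι → ℂ} {i₀ : ι} (hi₀ : i₀ ∈ T)
    (hw : ∀ i, i ∉ T → w i = 0) : Measurable[sigmaGen e T] (centredProd e w i₀) :=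
  ((measurable_star_comp (measurable_sum hw)).mul (measurable_sigmaGen hi₀)).sub_const _

variable [MeasurableSpace Ω] {μ : Measure Ω}

variable (e μ) in
/-- Independent, centred complex random variables with unit variance. -/
structure IsWhite : Prop where
  measurable : ∀ i, Measurable (e i)
  indep : iIndepFun e μ
  memLp : ∀ i, MemLp (e i) 2 μ
  mean : ∀ i, ∫ ω, e i ω ∂μ = 0
  power : ∀ i, ∫ ω, ‖e i ω‖ ^ 2 ∂μ = 1

namespace IsWhite

theorem sigmaGen_le (he : IsWhite e μ) (T : Set ι) : sigmaGen e T ≤ ‹MeasurableSpace Ω› :=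
  iSup₂_le fun i _ => (he.measurable i).comap_le

theorem measurable_of_sigmaGen (he : IsWhite e μ) {T : Set ι} {f : Ω → ℂ}
    (hf : Measurable[sigmaGen e T] f) : Measurable f :=
  hf.mono (he.sigmaGen_le T) le_rfl

theorem indepFun (he : IsWhite e μ) {S T : Set ι} (hST : Disjoint S T) {f g : Ω → ℂ}
    (hf : Measurable[sigmaGen e S] f) (hg : Measurable[sigmaGen e T] g) : IndepFun f g μ := by
  rw [IndepFun_iff_Indep]
  exact indep_of_indep_of_le_left (indep_of_indep_of_le_right
    (indep_iSup_of_disjoint (fun i => (he.measurable i).comap_le) he.indep hST) hg.comap_le)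
    hf.comap_le

theorem integral_mul (he : IsWhite e μ) {S T : Set ι} (hST : Disjoint S T) {f g : Ω → ℂ}
    (hf : Measurable[sigmaGen e S] f) (hg : Measurable[sigmaGen e T] g) :
    ∫ ω, f ω * g ω ∂μ = (∫ ω, f ω ∂μ) * ∫ ω, g ω ∂μ :=
  integral_mul_of_indepFun (he.indepFun hST hf hg) (he.measurable_of_sigmaGen hf)
    (he.measurable_of_sigmaGen hg)

theorem integral_mul_star [DecidableEq ι] (he : IsWhite e μ) (i j : ι) :
    ∫ ω, e i ω * star (e j ω) ∂μ = if i = j then 1 else 0 := by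
  split_ifs with h
  · subst h
    rw [← integral_norm_sq_eq, he.power]; simp
  · rw [he.integral_mul (S := {i}) (T := {j}) (by simpa using h) (measurable_sigmaGen rfl)
      (measurable_star_comp (measurable_sigmaGen rfl)), he.mean, zero_mul]

/-- Products of uncorrelated variables with centred variables living on independent blocks are
uncorrelated. -/
theorem integral_mul_mul_star {B X : Type*} [DecidableEq B] [DecidableEq X] (he : IsWhite e μ)
    {S : Set ι} {T : B → Set ι} (hST : ∀ b, Disjoint S (T b))
    (hT : ∀ b b', b ≠ b' → Disjoint (T b) (T b')) {t : X → Ω → ℂ} {Y : B → X → Ω → ℂ}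
    (ht : ∀ x, Measurable[sigmaGen e S] (t x))
    (htt : ∀ x x', ∫ ω, t x ω * star (t x' ω) ∂μ = if x = x' then 1 else 0)
    (hY : ∀ b x, Measurable[sigmaGen e (T b)] (Y b x)) (hY0 : ∀ b x, ∫ ω, Y b x ω ∂μ = 0)
    (b b' : B) (x x' : X) :
    ∫ ω, (t x ω * Y b x ω) * star (t x' ω * Y b' x' ω) ∂μ =
      if b = b' ∧ x = x' then ∫ ω, Y b x ω * star (Y b x ω) ∂μ else 0 := by
  have h1 : ∀ ω, (t x ω * Y b x ω) * star (t x' ω * Y b' x' ω) =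
      (t x ω * star (t x' ω)) * (Y b x ω * star (Y b' x' ω)) := fun ω => by
    rw [star_mul']; ring
  -- Both block variables are measurable with respect to the union of their blocks, which is
  -- disjoint from `S`; the pair of them can thus be separated from the `t` factors in one
  -- application of independence.
  have mono : ∀ c : B, c = b ∨ c = b' → ∀ {f : Ω → ℂ}, Measurable[sigmaGen e (T c)] f →
      Measurable[sigmaGen e (T b ∪ T b')] f := fun c hc f hf => by
    refine hf.mono (biSup_mono fun i hi => ?_) le_rfl
    rcases hc with rfl | rfl
    · exact Or.inl hi
    · exact Or.inr hi
  simp only [h1]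
  rw [he.integral_mul (S := S) (T := T b ∪ T b') ((hST b).union_right (hST b'))
    (measurable_mul_star_comp (ht x) (ht x'))
    (measurable_mul_star_comp (mono b (Or.inl rfl) (hY b x)) (mono b' (Or.inr rfl) (hY b' x'))),
    htt]
  by_cases hx : x = x'
  · subst hx
    by_cases hb : b = b'
    · subst hb; simp
    · rw [he.integral_mul (hT b b' hb) (hY b x) (measurable_star_comp (hY b' x)), hY0]
      simp [hb]
  · simp [hx]

variable [Fintype ι]

theorem memLp_sum (he : IsWhite e μ) (w : ι → ℂ) : MemLp (fun ω => ∑ i, w i * e i ω) 2 μ :=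
  memLp_finset_sum_const_mul _ _ fun i _ => he.memLp i

theorem integral_sum_mul_star_sum (he : IsWhite e μ) (w w' : ι → ℂ) :
    ∫ ω, (∑ i, w i * e i ω) * star (∑ i, w' i * e i ω) ∂μ = ∑ i, w i * star (w' i) := by
  classical
  rw [LSFD.integral_sum_mul_star_sum _ _ _ _ (fun i _ => he.memLp i) (fun i _ => he.memLp i)]
  simp only [he.integral_mul_star]; simp

theorem integral_mul_star_sum (he : IsWhite e μ) (i : ι) (w : ι → ℂ) :
    ∫ ω, e i ω * star (∑ i, w i * e i ω) ∂μ = star (w i) := by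
  classical
  have := he.integral_sum_mul_star_sum (Pi.single i 1) w
  simpa [Pi.single_apply] using this

theorem integral_sum (he : IsWhite e μ) [IsProbabilityMeasure μ] (w : ι → ℂ) :
    ∫ ω, ∑ i, w i * e i ω ∂μ = 0 := by
  rw [integral_finsetSum _ fun i _ => ((he.memLp i).integrable (by norm_num)).const_mul _]
  simp [integral_const_mul, he.mean]

theorem integral_centredProd (he : IsWhite e μ) [IsProbabilityMeasure μ] (w : ι → ℂ) (i₀ : ι) :
    ∫ ω, centredProd e w i₀ ω ∂μ = 0 := by
  simp only [centredProd]
  have h := he.integral_mul_star_sum i₀ w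
  simp only [mul_comm (e i₀ _)] at h
  rw [integral_sub _ (integrable_const _), h]
  · simp
  · simpa only [mul_comm] using integrable_mul_star (he.memLp i₀) (he.memLp_sum w)

/-- In the splitting `conj(w i₀) u + v` of `centredProd_eq`, `E|u|² = E|e i₀|⁴ - 2 + 1 = 1`, while
`E|v|²` is the sum of the remaining `|wᵢ|²` by independence, and the cross terms vanish because `R`
is centred. The fourth moment `2` is exactly what makes the `i₀` term count like all the others. -/
theorem memLp_and_integral_centredProd (he : IsWhite e μ) [IsProbabilityMeasure μ] (w : ι → ℂ)
    (i₀ : ι) (h4 : Integrable (fun ω => ‖e i₀ ω‖ ^ 4) μ) (h4' : ∫ ω, ‖e i₀ ω‖ ^ 4 ∂μ = 2) :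
    MemLp (centredProd e w i₀) 2 μ ∧
      ∫ ω, centredProd e w i₀ ω * star (centredProd e w i₀ ω) ∂μ = ∑ i, w i * star (w i) := by
  classical
  set u : Ω → ℂ := fun ω => (‖e i₀ ω‖ : ℂ) ^ 2 - 1 with hu
  set R : Ω → ℂ := fun ω => ∑ i, (Function.update w i₀ 0) i * e i ω with hR
  set v : Ω → ℂ := fun ω => e i₀ ω * star (R ω) with hv
  have h2 : Integrable (fun ω => ‖e i₀ ω‖ ^ 2) μ :=
    (memLp_two_iff_integrable_sq_norm (he.memLp i₀).1).1 (he.memLp i₀)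
  have hem : Measurable[sigmaGen e {i₀}] (e i₀) := measurable_sigmaGen rfl
  have hum : Measurable[sigmaGen e {i₀}] u :=
    Measurable.comp (g := fun z : ℂ => (‖z‖ : ℂ) ^ 2 - 1) (by fun_prop) hem
  -- Zeroing the coefficient at `i₀` makes `R` a function of the other sources only.
  have hRm : Measurable[sigmaGen e {i₀}ᶜ] R := measurable_sum fun i hi => by
    have : i = i₀ := by simpa using hi
    rw [this, Function.update_self]
  have hdis : Disjoint ({i₀} : Set ι) {i₀}ᶜ := disjoint_compl_right
  have hRL : MemLp R 2 μ := he.memLp_sum _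
  have hunorm : ∀ ω, ‖u ω‖ ^ 2 = ‖e i₀ ω‖ ^ 4 - 2 * ‖e i₀ ω‖ ^ 2 + 1 := fun ω => by
    have : u ω = ((‖e i₀ ω‖ ^ 2 - 1 : ℝ) : ℂ) := by simp [hu]
    rw [this, Complex.norm_real, Real.norm_eq_abs, sq_abs]; ring
  have huL : MemLp u 2 μ := by
    rw [memLp_two_iff_integrable_sq_norm (he.measurable_of_sigmaGen hum).aestronglyMeasurable]
    simp only [hunorm]
    exact (h4.sub (h2.const_mul 2)).add (integrable_const 1)
  have hind : IndepFun (e i₀) (fun ω => star (R ω)) μ :=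
    he.indepFun hdis hem (measurable_star_comp hRm)
  have hvL : MemLp v 2 μ := memLp_mul_of_indepFun hind (he.memLp i₀) hRL.star
  have huu : ∫ ω, u ω * star (u ω) ∂μ = 1 := by
    rw [← integral_norm_sq_eq]
    simp only [hunorm]
    rw [integral_add (f := fun ω => ‖e i₀ ω‖ ^ 4 - 2 * ‖e i₀ ω‖ ^ 2)
      (h4.sub (h2.const_mul 2)) (integrable_const 1), integral_sub h4 (h2.const_mul 2),
      integral_const_mul, h4', he.power]
    simp
  have huv : ∫ ω, u ω * star (v ω) ∂μ = 0 := by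
    have : ∀ ω, u ω * star (v ω) = (u ω * star (e i₀ ω)) * R ω := fun ω => by
      simp only [hv, star_mul', star_star]; ring
    simp only [this]
    rw [he.integral_mul hdis (measurable_mul_star_comp hum hem) hRm, he.integral_sum, mul_zero]
  have hvu : ∫ ω, v ω * star (u ω) ∂μ = 0 := by
    have : ∀ ω, v ω * star (u ω) = star (u ω * star (v ω)) := fun ω => by
      simp only [star_mul', star_star]; ring
    simp only [this]
    have := integral_conj (μ := μ) (f := fun ω => u ω * star (v ω))
    exact this.trans (by rw [huv, map_zero])
  have hvv : ∫ ω, v ω * star (v ω) ∂μ = ∑ i, (Function.update w i₀ 0) i *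
      star ((Function.update w i₀ 0) i) := by
    have : ∀ ω, v ω * star (v ω) = (e i₀ ω * star (e i₀ ω)) * (R ω * star (R ω)) := fun ω => by
      simp only [hv, star_mul', star_star]; ring
    simp only [this]
    rw [he.integral_mul hdis (measurable_mul_star_comp hem hem) (measurable_mul_star_comp hRm hRm),
      he.integral_mul_star,
      he.integral_sum_mul_star_sum, if_pos rfl, one_mul]
  -- The two-term splitting is indexed by `Bool` so that the general expansion of second moments of
  -- finite sums applies.
  have key : ∀ ω, centredProd e w i₀ ω = ∑ b : Bool, (bif b then star (w i₀) else 1) *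
      (bif b then u else v) ω := fun ω => by
    rw [centredProd_eq]; simp [hu, hv, hR]
  have hL : ∀ b ∈ (Finset.univ : Finset Bool), MemLp (bif b then u else v) 2 μ := by
    rintro (_ | _) _ <;> assumption
  constructor
  · rw [funext key]
    exact memLp_finset_sum_const_mul _ _ hL
  · simp only [key]
    rw [LSFD.integral_sum_mul_star_sum _ _ _ _ hL hL]
    simp only [Fintype.univ_bool, Finset.mem_singleton, Bool.true_eq_false, not_false_eq_true,
      Finset.sum_insert, Finset.sum_singleton, cond_true, cond_false, huu, huv, hvu, hvv]
    rw [← Finset.add_sum_erase _ (fun i => w i * star (w i)) (Finset.mem_univ i₀),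
      ← Finset.add_sum_erase _ (fun i => (Function.update w i₀ 0) i *
      star ((Function.update w i₀ 0) i)) (Finset.mem_univ i₀)]
    have : ∀ i ∈ Finset.univ.erase i₀, (Function.update w i₀ 0) i *
      star ((Function.update w i₀ 0) i) = w i * star (w i) := fun i hi => by
        rw [Function.update_of_ne (Finset.ne_of_mem_erase hi)]
    rw [Finset.sum_congr rfl this]
    simp [mul_comm]

end IsWhite

end White

/-! ### The received signals in terms of the sources -/

/-- Index type of the sources of randomness. -/
abbrev SourceIdx (L K M : ℕ) : Type :=
  (Fin L × Fin K × Fin L × Fin M) ⊕ (Fin L × Fin M × Fin K) ⊕ (Fin L × Fin M) ⊕ (Fin K × Fin L)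

section Sources
variable {L K M : ℕ} {Ω : Type*}

/-- The base station and the antenna at which a source is observed; `none` for data symbols. -/
def antenna : SourceIdx L K M → Option (Fin L × Fin M)
  | .inl (j, _, _, a) => some (j, a)
  | .inr (.inl (j, a, _)) => some (j, a)
  | .inr (.inr (.inl b)) => some b
  | .inr (.inr (.inr _)) => none

/-- Coefficients of `r` at a given antenna with respect to the sources. -/
def rCoeff (N : Network L K) (k : Fin K) (b : Fin L × Fin M) : SourceIdx L K M → ℂ
  | .inl (j, k', n, a) =>
      if j = b.1 then if a = b.2 then if k' = k then (√(N.β b.1 k n) : ℂ) * (√(N.p k n) : ℂ)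
        else 0 else 0 else 0
  | .inr (.inl (j, a, i)) => if j = b.1 then if a = b.2 then star (N.Φ k i) else 0 else 0
  | .inr (.inr (.inl _)) => 0
  | .inr (.inr (.inr _)) => 0

/-- The source multiplying a given data symbol (or `1`, for `none`) at a given antenna. -/
def channelIdx (b : Fin L × Fin M) : Option (Fin K × Fin L) → SourceIdx L K M
  | none => .inr (.inr (.inl b))
  | some (m, n) => .inl (b.1, m, n, b.2)

/-- Amplitude with which a data symbol (or the noise, for `none`) is received. -/
def dataCoeff (N : Network L K) (j : Fin L) : Option (Fin K × Fin L) → ℂ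
  | none => 1
  | some (m, n) => (√(N.β j m n) : ℂ) * (√(N.q m n) : ℂ)

/-- The data symbols, together with the constant `1`. -/
def symbol (S : Signals L K M Ω) : Option (Fin K × Fin L) → Ω → ℂ
  | none => fun _ => 1
  | some (m, n) => S.s m n

/-- Power of a component of `r_{kj}`, the number `1 + ∑ᵢ β_{jki} p_{ki}`. -/
def rPower (N : Network L K) (k : Fin K) (j : Fin L) : ℝ := 1 + ∑ i, N.β j k i * N.p k i

theorem antenna_channelIdx (b : Fin L × Fin M) (x : Option (Fin K × Fin L)) :
    antenna (channelIdx b x) = some b := by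
  rcases x with _ | ⟨m, n⟩ <;> rfl

theorem disjoint_antenna {u v : Option (Fin L × Fin M)} (h : u ≠ v) :
    Disjoint (antenna (K := K) ⁻¹' {u}) (antenna ⁻¹' {v}) :=
  Disjoint.preimage _ (by simpa using h)

theorem rCoeff_eq_zero (N : Network L K) (k : Fin K) (b : Fin L × Fin M) (i : SourceIdx L K M)
    (hi : i ∉ antenna ⁻¹' {some b}) : rCoeff N k b i = 0 := by
  obtain ⟨b1, b2⟩ := b
  rcases i with ⟨j, k', n, a⟩ | ⟨j, a, i⟩ | ⟨j, a⟩ | ⟨m, n⟩ <;>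
    simp [antenna, rCoeff] at hi ⊢ <;> tauto

/-- Multiplication by `Φᴴ` cancels `Φ`, so only the users with pilot index `k` survive; the training
noise is merely rotated, which gives the coefficients `star (N.Φ k i)`. -/
theorem r_eq_sum (N : Network L K) (S : Signals L K M Ω) (hΦ : N.Φ * N.Φᴴ = 1) (k : Fin K)
    (j : Fin L) (ω : Ω) (a : Fin M) :
    r N S k j ω a = ∑ i, rCoeff N k (j, a) i * S.source i ω := by
  simp only [r, trainingSignal, Matrix.add_mul, Matrix.sum_mul, Matrix.mul_assoc, hΦ,
    Matrix.mul_one, Matrix.add_apply, Matrix.sum_apply, Matrix.of_apply,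
    Fintype.sum_sum_type, Fintype.sum_prod_type, rCoeff, Signals.source, ite_mul, zero_mul,
    Finset.sum_const_zero, add_zero, g, Matrix.mul_apply (M := Matrix.of _),
    Matrix.conjTranspose_apply]
  simp only [Finset.sum_ite_irrel, Finset.sum_const_zero, Finset.sum_ite_eq', Finset.mem_univ,
    if_true]
  congr 1
  · exact Finset.sum_congr rfl fun n _ => by simp [Matrix.diagonal_apply]; ring
  · exact Finset.sum_congr rfl fun n _ => by ring

/-- At distinct antennas the coefficient vectors have disjoint supports. At one antenna the users
contribute `β p` each, and the noise contributes `1` because the rows of `Φ` are unit vectors. -/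
theorem sum_rCoeff_mul_star (N : Network L K) (hΦ : N.Φ * N.Φᴴ = 1)
    (hβ : ∀ j m n, 0 < N.β j m n) (hp : ∀ m n, 0 ≤ N.p m n) (k : Fin K)
    (b b' : Fin L × Fin M) :
    ∑ i, rCoeff N k b i * star (rCoeff N k b' i) =
      if b = b' then (rPower N k b.1 : ℂ) else 0 := by
  split_ifs with h
  · subst h
    have h1 : ∑ i, star (N.Φ k i) * N.Φ k i = 1 := by
      have := congrFun (congrFun hΦ k) k
      simpa [Matrix.mul_apply, mul_comm] using this
    simp only [Fintype.sum_sum_type, Fintype.sum_prod_type, rCoeff, ite_mul, zero_mul,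
      Finset.sum_ite_irrel, Finset.sum_const_zero, Finset.sum_ite_eq', Finset.mem_univ, if_true,
      add_zero, star_star, h1, rPower]
    push_cast
    rw [add_comm]
    congr 1
    refine Finset.sum_congr rfl fun n _ => ?_
    simp only [star_mul', RCLike.star_def, Complex.conj_ofReal]
    have e1 := Real.mul_self_sqrt (hβ b.1 k n).le
    have e2 := Real.mul_self_sqrt (hp k n)
    calc _ = ((√(N.β b.1 k n) * √(N.β b.1 k n) * (√(N.p k n) * √(N.p k n)) : ℝ) : ℂ) := by
          push_cast; ring
      _ = _ := by rw [e1, e2]; push_cast; ring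
  · refine Finset.sum_eq_zero fun i _ => ?_
    by_cases hi : antenna i = some b
    · rw [rCoeff_eq_zero N k b' i (by simpa [hi] using h), star_zero, mul_zero]
    · rw [rCoeff_eq_zero N k b i hi, zero_mul]

theorem rPower_pos (N : Network L K) (hβ : ∀ j m n, 0 < N.β j m n) (hp : ∀ m n, 0 ≤ N.p m n)
    (k : Fin K) (j : Fin L) : 0 < rPower N k j :=
  add_pos_of_pos_of_nonneg one_pos
    (Finset.sum_nonneg fun _ _ => mul_nonneg (hβ _ _ _).le (hp _ _))

theorem measurable_symbol (S : Signals L K M Ω) (x : Option (Fin K × Fin L)) :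
    Measurable[sigmaGen S.source (antenna ⁻¹' {none})] (symbol S x) := by
  rcases x with _ | ⟨m, n⟩
  · exact measurable_const
  · exact measurable_sigmaGen (e := S.source) (i := .inr (.inr (.inr (m, n)))) rfl

theorem measurable_centredProd_channel (N : Network L K) (S : Signals L K M Ω) (k : Fin K)
    (b : Fin L × Fin M) (x : Option (Fin K × Fin L)) :
    Measurable[sigmaGen S.source (antenna ⁻¹' {some b})]
      (centredProd S.source (rCoeff N k b) (channelIdx b x)) :=
  measurable_centredProd (antenna_channelIdx b x) (rCoeff_eq_zero N k b)

variable [MeasurableSpace Ω] {μ : Measure Ω}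

theorem norm_pow_four_of_map_eq {f : Ω → ℂ} (hf : Measurable f) (h : μ.map f = complexGaussian) :
    Integrable (fun ω => ‖f ω‖ ^ 4) μ ∧ ∫ ω, ‖f ω‖ ^ 4 ∂μ = 2 := by
  have h1 := integrable_norm_pow_four_complexGaussian
  have h2 := integral_norm_pow_four_complexGaussian
  rw [← h] at h1 h2
  refine ⟨h1.comp_measurable hf, ?_⟩
  rwa [integral_map hf.aemeasurable (by fun_prop)] at h2

theorem standardized_of_map_eq {f : Ω → ℂ} (hf : Measurable f) (h : μ.map f = complexGaussian) :
    MemLp f 2 μ ∧ ∫ ω, f ω ∂μ = 0 ∧ ∫ ω, ‖f ω‖ ^ 2 ∂μ = 1 := by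
  have h1 : MemLp (fun z : ℂ => z) 2 complexGaussian :=
    memLp_id_complexGaussian.mono_exponent (by norm_num)
  have h2 := integral_norm_sq_complexGaussian
  have h3 := integral_id_complexGaussian
  rw [← h] at h1 h2 h3
  refine ⟨h1.comp_of_map hf.aemeasurable, ?_, ?_⟩
  · rwa [integral_map hf.aemeasurable (by fun_prop)] at h3
  · rwa [integral_map hf.aemeasurable (by fun_prop)] at h2

variable {S : Signals L K M Ω}

theorem Signals.IsModel.standardized (hS : S.IsModel μ) (i : SourceIdx L K M) :
    MemLp (S.source i) 2 μ ∧ ∫ ω, S.source i ω ∂μ = 0 ∧ ∫ ω, ‖S.source i ω‖ ^ 2 ∂μ = 1 := by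
  rcases i with ⟨j, k, n, a⟩ | ⟨j, a, i⟩ | ⟨j, a⟩ | ⟨m, n⟩
  · exact standardized_of_map_eq (hS.measurable _) (hS.law_h _ _ _ _)
  · exact standardized_of_map_eq (hS.measurable _) (hS.law_Z _ _ _)
  · exact standardized_of_map_eq (hS.measurable _) (hS.law_z _ _)
  · exact ⟨hS.memLp_s _ _, hS.mean_s _ _, hS.power_s _ _⟩

theorem Signals.IsModel.isWhite (hS : S.IsModel μ) : IsWhite S.source μ where
  measurable := hS.measurable
  indep := hS.indep
  memLp i := (hS.standardized i).1
  mean i := (hS.standardized i).2.1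
  power i := (hS.standardized i).2.2

theorem Signals.IsModel.norm_pow_four_channel (hS : S.IsModel μ) (b : Fin L × Fin M)
    (x : Option (Fin K × Fin L)) :
    Integrable (fun ω => ‖S.source (channelIdx b x) ω‖ ^ 4) μ ∧
      ∫ ω, ‖S.source (channelIdx b x) ω‖ ^ 4 ∂μ = 2 := by
  rcases x with _ | ⟨m, n⟩
  · exact norm_pow_four_of_map_eq (hS.measurable _) (hS.law_z _ _)
  · exact norm_pow_four_of_map_eq (hS.measurable _) (hS.law_h _ _ _ _)

theorem memLp_symbol [IsProbabilityMeasure μ] (hS : S.IsModel μ) (x : Option (Fin K × Fin L)) :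
    MemLp (symbol S x) 2 μ := by
  rcases x with _ | ⟨m, n⟩
  · exact memLp_const 1
  · exact hS.memLp_s m n

/-- The constant `1` is orthogonal to the data symbols because these are centred, so receiver noise
and interference can be handled as one orthonormal family. -/
theorem integral_symbol_mul_star [IsProbabilityMeasure μ] (hS : S.IsModel μ)
    (x x' : Option (Fin K × Fin L)) :
    ∫ ω, symbol S x ω * star (symbol S x' ω) ∂μ = if x = x' then 1 else 0 := by
  rcases x with _ | ⟨m, n⟩ <;> rcases x' with _ | ⟨m', n'⟩
  · simp [symbol]
  · have := (integral_conj (μ := μ) (f := S.s m' n'))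
    rw [hS.mean_s, map_zero] at this
    simpa [symbol] using this
  · simpa [symbol] using hS.mean_s m n
  · have := hS.isWhite.integral_mul_star (.inr (.inr (.inr (m, n)))) (.inr (.inr (.inr (m', n'))))
    simpa only [Option.some.injEq, Sum.inr.injEq, Signals.source, symbol] using this

/-- The component of the received signal that results from an antenna and a data symbol. -/
def component (N : Network L K) (S : Signals L K M Ω) (k : Fin K) (b : Fin L × Fin M)
    (x : Option (Fin K × Fin L)) (ω : Ω) : ℂ :=
  symbol S x ω * centredProd S.source (rCoeff N k b) (channelIdx b x) ω

/-! ### The channel estimate and the effective gains -/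

theorem gHat_eq (hS : S.IsModel μ) (hΦ : N.Φ * N.Φᴴ = 1)
    (hβ : ∀ j m n, 0 < N.β j m n) (hp : ∀ m n, 0 ≤ N.p m n) (j : Fin L) (k : Fin K) (ω : Ω) :
    gHat N S μ j k ω = (eta N k j : ℂ) • r N S k j ω := by
  have hA := rPower_pos N hβ hp k j
  have h1 : corr μ (r N S k j) (r N S k j) =
      (rPower N k j : ℂ) • (1 : Matrix (Fin M) (Fin M) ℂ) := by
    ext a b
    simp only [corr, Matrix.of_apply, r_eq_sum N S hΦ]
    rw [hS.isWhite.integral_sum_mul_star_sum, sum_rCoeff_mul_star N hΦ hβ hp]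
    simp [Matrix.one_apply]
  have h2 : corr μ (g N S j k j) (r N S k j) =
      ((N.β j k j * √(N.p k j) : ℝ) : ℂ) • (1 : Matrix (Fin M) (Fin M) ℂ) := by
    ext a b
    simp only [corr, Matrix.of_apply, r_eq_sum N S hΦ, g, mul_assoc, integral_const_mul]
    have := hS.isWhite.integral_mul_star_sum (.inl (j, k, j, a)) (rCoeff N k (j, b))
    rw [show S.h j k j a = S.source (.inl (j, k, j, a)) from rfl, this]
    have e := Real.mul_self_sqrt (hβ j k j).le
    by_cases hab : a = b
    · subst hab
      simp only [rCoeff, if_true, star_mul', RCLike.star_def, Complex.conj_ofReal,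
        Matrix.smul_apply, Matrix.one_apply_eq, smul_eq_mul, mul_one]
      rw [← mul_assoc, ← Complex.ofReal_mul, e]; push_cast; rfl
    · simp [rCoeff, hab]
  have hinv : ((rPower N k j : ℂ) • (1 : Matrix (Fin M) (Fin M) ℂ))⁻¹ =
      (rPower N k j : ℂ)⁻¹ • 1 := by
    have hA' : (rPower N k j : ℂ) ≠ 0 := by exact_mod_cast hA.ne'
    exact Matrix.inv_eq_right_inv (by
      rw [Matrix.smul_mul, Matrix.mul_smul, Matrix.one_mul, smul_smul,
        mul_inv_cancel₀ hA', one_smul])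
  rw [gHat, h1, h2, hinv]
  simp only [Matrix.smul_mul, Matrix.mul_smul, Matrix.one_mul, smul_smul, Matrix.smul_mulVec,
    Matrix.one_mulVec]
  congr 1
  simp only [eta, rPower]
  push_cast
  ring

variable {N : Network L K}

/-- The mean of the effective gain, with respect to an arbitrary user. -/
def gainMean (M : ℕ) (N : Network L K) (j : Fin L) (k m : Fin K) (n : Fin L) : ℂ :=
  if m = k then ((M * eta N k j * N.β j k n * √(N.p k n) : ℝ) : ℂ) else 0

/-- At each antenna the mean of `conj(r) h` is the conjugate coefficient of that fading variable in
`r`, which is nonzero only for users with pilot index `k`; the rest is the centred fluctuation. -/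
theorem gain_eq (hS : S.IsModel μ) (hΦ : N.Φ * N.Φᴴ = 1)
    (hβ : ∀ j m n, 0 < N.β j m n) (hp : ∀ m n, 0 ≤ N.p m n) (j : Fin L) (k m : Fin K) (n : Fin L)
    (ω : Ω) : gain N S μ j k m n ω = gainMean M N j k m n + ∑ a : Fin M,
      (eta N k j : ℂ) * (√(N.β j m n) : ℂ) *
        centredProd S.source (rCoeff N k (j, a)) (channelIdx (j, a) (some (m, n))) ω := by
  have h1 : ∀ a : Fin M, star (r N S k j ω a) * g N S j m n ω a =
      (√(N.β j m n) : ℂ) * (centredProd S.source (rCoeff N k (j, a))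
        (channelIdx (j, a) (some (m, n))) ω +
          star (rCoeff N k (j, a) (channelIdx (j, a) (some (m, n))))) := fun a => by
    rw [centredProd, r_eq_sum N S hΦ, g]
    simp only [channelIdx, Signals.source]
    ring
  have h2 : ∀ a : Fin M, (√(N.β j m n) : ℂ) *
      star (rCoeff N k (j, a) (channelIdx (j, a) (some (m, n)))) =
        if m = k then ((N.β j k n * √(N.p k n) : ℝ) : ℂ) else 0 := fun a => by
    simp only [channelIdx, rCoeff, if_true]
    split_ifs with h
    · subst h
      have e := Real.mul_self_sqrt (hβ j m n).le
      simp only [star_mul', RCLike.star_def, Complex.conj_ofReal]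
      rw [← mul_assoc, ← Complex.ofReal_mul, e]; push_cast; rfl
    · simp
  rw [gain, gHat_eq hS hΦ hβ hp]
  have h3 : ∀ a : Fin M, star ((eta N k j : ℂ) * r N S k j ω a) * g N S j m n ω a =
      (eta N k j : ℂ) * (if m = k then ((N.β j k n * √(N.p k n) : ℝ) : ℂ) else 0) +
        (eta N k j : ℂ) * (√(N.β j m n) : ℂ) * centredProd S.source (rCoeff N k (j, a))
        (channelIdx (j, a) (some (m, n))) ω := fun a => by
    rw [star_mul', mul_assoc, h1, ← h2 a, RCLike.star_def, Complex.conj_ofReal]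
    ring
  simp only [dotProduct, Pi.star_apply, Pi.smul_apply, smul_eq_mul, h3, Finset.sum_add_distrib]
  congr 1
  simp only [gainMean]
  split_ifs
  · simp; ring
  · simp

variable [IsProbabilityMeasure μ]

/-! ### Second moments of the components -/

theorem memLp_component (hS : S.IsModel μ) (k : Fin K) (b : Fin L × Fin M)
    (x : Option (Fin K × Fin L)) : MemLp (component N S k b x) 2 μ := by
  have h4 := hS.norm_pow_four_channel b x
  exact memLp_mul_of_indepFun (hS.isWhite.indepFun (disjoint_antenna (Option.some_ne_none b).symm)
    (measurable_symbol S x) (measurable_centredProd_channel N S k b x)) (memLp_symbol hS x)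
    (hS.isWhite.memLp_and_integral_centredProd _ _ h4.1 h4.2).1

theorem integral_component (hS : S.IsModel μ) (k : Fin K) (b : Fin L × Fin M)
    (x : Option (Fin K × Fin L)) : ∫ ω, component N S k b x ω ∂μ = 0 := by
  simp only [component]
  rw [hS.isWhite.integral_mul (disjoint_antenna (Option.some_ne_none b).symm)
    (measurable_symbol S x) (measurable_centredProd_channel N S k b x),
    hS.isWhite.integral_centredProd, mul_zero]

theorem integral_component_mul_star_symbol (hS : S.IsModel μ) (k : Fin K) (b : Fin L × Fin M)
    (x x' : Option (Fin K × Fin L)) :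
    ∫ ω, component N S k b x ω * star (symbol S x' ω) ∂μ = 0 := by
  have : ∀ ω, component N S k b x ω * star (symbol S x' ω) =
      (symbol S x ω * star (symbol S x' ω)) *
        centredProd S.source (rCoeff N k b) (channelIdx b x) ω := fun ω => by
    rw [component]; ring
  simp only [this]
  rw [hS.isWhite.integral_mul (disjoint_antenna (Option.some_ne_none b).symm)
    (measurable_mul_star_comp (measurable_symbol S x) (measurable_symbol S x'))
    (measurable_centredProd_channel N S k b x), hS.isWhite.integral_centredProd, mul_zero]

/-- For distinct symbols the symbol factors are orthogonal; for distinct antennas the fluctuations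
are independent and centred. The variance does not depend on `x`: users sharing the pilot, other
users and receiver noise all give `rPower`. -/
theorem integral_component_mul_star (hS : S.IsModel μ) (hΦ : N.Φ * N.Φᴴ = 1)
    (hβ : ∀ j m n, 0 < N.β j m n) (hp : ∀ m n, 0 ≤ N.p m n) (k : Fin K) (b b' : Fin L × Fin M)
    (x x' : Option (Fin K × Fin L)) :
    ∫ ω, component N S k b x ω * star (component N S k b' x' ω) ∂μ =
      if b = b' ∧ x = x' then (rPower N k b.1 : ℂ) else 0 := by
  have h4 := hS.norm_pow_four_channel b x
  have := hS.isWhite.integral_mul_mul_star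
    (fun b => disjoint_antenna (Option.some_ne_none b).symm)
    (fun b b' hb => disjoint_antenna (by simpa using hb)) (measurable_symbol S)
    (integral_symbol_mul_star hS) (measurable_centredProd_channel N S k)
    (fun b x => hS.isWhite.integral_centredProd _ _) b b' x x'
  rw [(hS.isWhite.memLp_and_integral_centredProd _ _ h4.1 h4.2).2,
    sum_rCoeff_mul_star N hΦ hβ hp, if_pos rfl] at this
  exact this

theorem meanGain_eq (hS : S.IsModel μ) (hΦ : N.Φ * N.Φᴴ = 1)
    (hβ : ∀ j m n, 0 < N.β j m n) (hp : ∀ m n, 0 ≤ N.p m n) (j : Fin L) (k : Fin K) (n : Fin L) :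
    meanGain N S μ j k n = ((M * eta N k j * N.β j k n * √(N.p k n) : ℝ) : ℂ) := by
  have hint : ∀ a : Fin M, Integrable (centredProd S.source (rCoeff N k (j, a))
      (channelIdx (j, a) (some (k, n)))) μ := fun a =>
    have h4 := hS.norm_pow_four_channel (j, a) (some (k, n))
    (hS.isWhite.memLp_and_integral_centredProd _ _ h4.1 h4.2).1.integrable (by norm_num)
  simp only [meanGain, gain_eq hS hΦ hβ hp]
  rw [integral_add (integrable_const _) (integrable_finsetSum _ fun a _ => (hint a).const_mul _),
    integral_finsetSum _ fun a _ => (hint a).const_mul _]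
  simp [integral_const_mul, hS.isWhite.integral_centredProd, gainMean]

/-! ### The interference plus noise at one base station -/

/-- The contribution of base station `j` to the interference plus noise. -/
def localNoise (N : Network L K) (S : Signals L K M Ω) (k : Fin K) (j : Fin L) (ω : Ω) : ℂ :=
  ∑ i : Fin M × Option (Fin K × Fin L),
    ((eta N k j : ℂ) * dataCoeff N j i.2) * component N S k (j, i.1) i.2 ω

theorem memLp_localNoise (hS : S.IsModel μ) (k : Fin K) (j : Fin L) :
    MemLp (localNoise N S k j) 2 μ :=
  memLp_finset_sum_const_mul _ _ fun _ _ => memLp_component hS _ _ _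

theorem integral_localNoise (hS : S.IsModel μ) (k : Fin K) (j : Fin L) :
    ∫ ω, localNoise N S k j ω ∂μ = 0 := by
  simp only [localNoise]
  rw [integral_finsetSum _ fun i _ =>
    ((memLp_component hS k (j, i.1) i.2).integrable (by norm_num)).const_mul _]
  simp [integral_const_mul, integral_component hS]

theorem integral_localNoise_mul_star_symbol (hS : S.IsModel μ) (k : Fin K) (j : Fin L)
    (x : Option (Fin K × Fin L)) :
    ∫ ω, localNoise N S k j ω * star (symbol S x ω) ∂μ = 0 := by
  simp only [localNoise, Finset.sum_mul, mul_assoc]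
  rw [integral_finsetSum _ fun i _ => ((integrable_mul_star (memLp_component hS k (j, i.1) i.2)
    (memLp_symbol hS x)).const_mul _).const_mul _]
  simp only [integral_const_mul, integral_component_mul_star_symbol hS, mul_zero,
    Finset.sum_const_zero]

/-- Since all components at station `j` have the same variance `rPower`, the sum over symbols
factors out as `∑ |dataCoeff|²`, the second factor of `lam`; the sum over antennas gives `M`. -/
theorem integral_localNoise_mul_star (hS : S.IsModel μ) (hΦ : N.Φ * N.Φᴴ = 1)
    (hβ : ∀ j m n, 0 < N.β j m n) (hp : ∀ m n, 0 ≤ N.p m n) (hq : ∀ m n, 0 ≤ N.q m n)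
    (k : Fin K) (j j' : Fin L) :
    ∫ ω, localNoise N S k j ω * star (localNoise N S k j' ω) ∂μ =
      if j = j' then ((M * eta N k j ^ 2 * lam N j k : ℝ) : ℂ) else 0 := by
  simp only [localNoise]
  rw [integral_sum_mul_star_sum _ _ _ _ (fun _ _ => memLp_component hS _ _ _)
    (fun _ _ => memLp_component hS _ _ _)]
  simp only [integral_component_mul_star hS hΦ hβ hp]
  split_ifs with h
  · subst h
    have e : ∀ i i' : Fin M × Option (Fin K × Fin L),
        ((j, i.1) = (j, i'.1) ∧ i.2 = i'.2) ↔ i = i' := fun i i' => by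
      simp [Prod.ext_iff]
    have hd : ∑ x, dataCoeff N j x * star (dataCoeff N j x) =
        ((1 + ∑ n, ∑ m, N.β j m n * N.q m n : ℝ) : ℂ) := by
      rw [Fintype.sum_option, Fintype.sum_prod_type, Finset.sum_comm]
      push_cast
      congr 1
      · simp [dataCoeff]
      · refine Finset.sum_congr rfl fun n _ => Finset.sum_congr rfl fun m _ => ?_
        have e1 := Real.mul_self_sqrt (hβ j m n).le
        have e2 := Real.mul_self_sqrt (hq m n)
        simp only [dataCoeff, star_mul', RCLike.star_def, Complex.conj_ofReal]
        calc _ = ((√(N.β j m n) * √(N.β j m n) * (√(N.q m n) * √(N.q m n)) : ℝ) : ℂ) := by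
              push_cast; ring
          _ = _ := by rw [e1, e2]; push_cast; ring
    simp only [e, mul_ite, mul_zero, Finset.sum_ite_eq, Finset.mem_univ, if_true]
    rw [Fintype.sum_prod_type]
    have : ∀ x, (eta N k j : ℂ) * dataCoeff N j x * star ((eta N k j : ℂ) * dataCoeff N j x) *
        (rPower N k j : ℂ) = ((eta N k j ^ 2 * rPower N k j : ℝ) : ℂ) *
          (dataCoeff N j x * star (dataCoeff N j x)) := fun x => by
      rw [star_mul', RCLike.star_def, Complex.conj_ofReal]; push_cast; ring
    simp only [this, ← Finset.mul_sum, hd]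
    simp only [Finset.sum_const, Finset.card_univ, Fintype.card_fin, lam, rPower]
    simp; ring
  · refine Finset.sum_eq_zero fun i _ => Finset.sum_eq_zero fun i' _ => ?_
    rw [if_neg (by simp [h]), mul_zero]

theorem localNoise_eq (hS : S.IsModel μ) (hΦ : N.Φ * N.Φᴴ = 1)
    (hβ : ∀ j m n, 0 < N.β j m n) (hp : ∀ m n, 0 ≤ N.p m n) (k : Fin K) (j : Fin L) (ω : Ω) :
    localNoise N S k j ω =
      ∑ n, (gain N S μ j k k n ω - meanGain N S μ j k n) * (√(N.q k n) : ℂ) * S.s k n ω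
        + ∑ n, ∑ m ∈ Finset.univ.erase k, gain N S μ j k m n ω * (√(N.q m n) : ℂ) * S.s m n ω
        + (star (gHat N S μ j k ω) ⬝ᵥ fun m => S.z j m ω) := by
  have h1 : ∀ n m, (gain N S μ j k m n ω - gainMean M N j k m n) * (√(N.q m n) : ℂ) * S.s m n ω =
      ∑ a : Fin M, ((eta N k j : ℂ) * dataCoeff N j (some (m, n))) *
        component N S k (j, a) (some (m, n)) ω := fun n m => by
    rw [gain_eq hS hΦ hβ hp, add_sub_cancel_left, Finset.sum_mul, Finset.sum_mul]
    refine Finset.sum_congr rfl fun a _ => ?_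
    simp only [dataCoeff, component, symbol]
    ring
  -- The data-phase noise `z` does not enter `r`, so its centring constant is zero and the plain
  -- product is already a component.
  have h2 : (star (gHat N S μ j k ω) ⬝ᵥ fun m => S.z j m ω) = ∑ a : Fin M,
      ((eta N k j : ℂ) * dataCoeff N j none) * component N S k (j, a) none ω := by
    rw [gHat_eq hS hΦ hβ hp]
    refine Finset.sum_congr rfl fun a _ => ?_
    simp only [Pi.star_apply, Pi.smul_apply, smul_eq_mul, r_eq_sum N S hΦ, dataCoeff, component,
      symbol, centredProd, channelIdx, rCoeff, star_mul', star_zero, sub_zero, Signals.source,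
      RCLike.star_def, Complex.conj_ofReal]
    ring
  -- Users with another pilot have mean gain zero, so subtracting `gainMean` from every gain merges
  -- the two kinds of interference.
  have h3 : ∀ n, (gain N S μ j k k n ω - meanGain N S μ j k n) * (√(N.q k n) : ℂ) * S.s k n ω
      + ∑ m ∈ Finset.univ.erase k, gain N S μ j k m n ω * (√(N.q m n) : ℂ) * S.s m n ω =
      ∑ m, (gain N S μ j k m n ω - gainMean M N j k m n) * (√(N.q m n) : ℂ) * S.s m n ω :=
    fun n => by
    rw [← Finset.add_sum_erase _ _ (Finset.mem_univ k), meanGain_eq hS hΦ hβ hp]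
    congr 1
    · simp [gainMean]
    · refine Finset.sum_congr rfl fun m hm => ?_
      simp [gainMean, Finset.ne_of_mem_erase hm]
  rw [← Finset.sum_add_distrib, Finset.sum_congr rfl fun n _ => h3 n, h2]
  simp only [h1]
  rw [localNoise, Fintype.sum_prod_type_right, Fintype.sum_option, Fintype.sum_prod_type_right,
    add_comm]

theorem sTilde_eq (hS : S.IsModel μ) (hΦ : N.Φ * N.Φᴴ = 1)
    (hβ : ∀ j m n, 0 < N.β j m n) (hp : ∀ m n, 0 ≤ N.p m n) (k : Fin K) (j : Fin L) (ω : Ω) :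
    sTilde N S μ k j ω = ∑ n, (meanGain N S μ j k n * (√(N.q k n) : ℂ)) * symbol S (some (k, n)) ω
      + localNoise N S k j ω := by
  have h1 : sTilde N S μ k j ω =
      ∑ n, ∑ m, gain N S μ j k m n ω * (√(N.q m n) : ℂ) * S.s m n ω
        + (star (gHat N S μ j k ω) ⬝ᵥ fun m => S.z j m ω) := by
    simp only [sTilde, gain, y, dotProduct, mul_add, Finset.sum_add_distrib, Finset.mul_sum,
      Finset.sum_mul]
    congr 1
    rw [Finset.sum_comm]
    refine Finset.sum_congr rfl fun n _ => ?_
    rw [Finset.sum_comm]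
    refine Finset.sum_congr rfl fun m _ => Finset.sum_congr rfl fun i _ => by ring
  rw [h1, localNoise_eq hS hΦ hβ hp, ← add_assoc, ← add_assoc, ← Finset.sum_add_distrib,
    ← Finset.sum_add_distrib]
  congr 1
  refine Finset.sum_congr rfl fun n _ => ?_
  rw [← Finset.add_sum_erase _ _ (Finset.mem_univ k)]
  simp only [symbol]
  ring

theorem interferenceNoise_eq (hS : S.IsModel μ) (hΦ : N.Φ * N.Φᴴ = 1)
    (hβ : ∀ j m n, 0 < N.β j m n) (hp : ∀ m n, 0 ≤ N.p m n) (k : Fin K) (l : Fin L)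
    (a : N.nbhd l → ℂ) (ω : Ω) :
    interferenceNoise N S μ k l a ω = ∑ j : N.nbhd l, star (a j) * localNoise N S k j ω := by
  simp only [localNoise_eq hS hΦ hβ hp, interferenceNoise, mul_add, Finset.sum_add_distrib,
    Finset.mul_sum, ← mul_assoc]
  congr 2
  · exact Finset.sum_comm
  · rw [Finset.sum_comm (s := (Finset.univ : Finset (N.nbhd l)))]
    exact Finset.sum_congr rfl fun n _ => Finset.sum_comm

end Sources

/-! ### Quadratic forms -/

section Quadratic
variable {ι ν : Type*}

/-- A positive combination of rank one matrices plus a diagonal matrix. -/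
def gramDiag [DecidableEq ι] (s : Finset ν) (w : ν → ℝ) (u : ν → ι → ℝ) (d : ι → ℝ) :
    Matrix ι ι ℝ :=
  ∑ n ∈ s, w n • Matrix.vecMulVec (u n) (u n) + Matrix.diagonal d

theorem transpose_gramDiag [DecidableEq ι] (s : Finset ν) (w : ν → ℝ) (u : ν → ι → ℝ) (d : ι → ℝ) :
    (gramDiag s w u d)ᵀ = gramDiag s w u d := by
  simp [gramDiag, Matrix.transpose_sum, Matrix.transpose_vecMulVec]

variable [Fintype ι]

/-- The Hermitian form of `gramDiag`. -/
def gramDiagForm (s : Finset ν) (w : ν → ℝ) (u : ν → ι → ℝ) (d : ι → ℝ) (b : ι → ℂ) : ℝ :=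
  ∑ n ∈ s, w n * ‖∑ j, star (b j) * (u n j : ℂ)‖ ^ 2 + ∑ j, d j * ‖b j‖ ^ 2

/-- As `v` is real, real and imaginary parts of `b` decouple, which reduces the complex forms to
real ones. -/
theorem norm_sq_sum_star_mul (b : ι → ℂ) (v : ι → ℝ) : ‖∑ j, star (b j) * (v j : ℂ)‖ ^ 2 =
    ((fun j => (b j).re) ⬝ᵥ v) ^ 2 + ((fun j => (b j).im) ⬝ᵥ v) ^ 2 := by
  rw [← Complex.normSq_eq_norm_sq, Complex.normSq_apply]
  simp only [Complex.re_sum, Complex.im_sum, dotProduct]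
  simp
  ring

theorem gramDiagForm_pos {s : Finset ν} {w : ν → ℝ} {u : ν → ι → ℝ} {d : ι → ℝ}
    (hw : ∀ n, 0 ≤ w n) (hd : ∀ j, 0 < d j) {b : ι → ℂ} (hb : b ≠ 0) :
    0 < gramDiagForm s w u d b := by
  obtain ⟨j, hj⟩ := Function.ne_iff.1 hb
  exact add_pos_of_nonneg_of_pos (Finset.sum_nonneg fun n _ => mul_nonneg (hw n) (sq_nonneg _))
    (Finset.sum_pos' (fun j _ => mul_nonneg (hd j).le (sq_nonneg _)) ⟨j, Finset.mem_univ _,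
      mul_pos (hd j) (pow_pos (norm_pos_iff.2 hj) 2)⟩)

variable [DecidableEq ι]

theorem dotProduct_gramDiag_mulVec (s : Finset ν) (w : ν → ℝ) (u : ν → ι → ℝ) (d : ι → ℝ)
    (b : ι → ℝ) : b ⬝ᵥ gramDiag s w u d *ᵥ b =
      ∑ n ∈ s, w n * (b ⬝ᵥ u n) ^ 2 + ∑ j, d j * b j ^ 2 := by
  rw [gramDiag, Matrix.add_mulVec, dotProduct_add, Matrix.sum_mulVec, dotProduct_sum]
  congr 1
  · refine Finset.sum_congr rfl fun n _ => ?_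
    rw [Matrix.smul_mulVec, dotProduct_smul, Matrix.vecMulVec_mulVec, dotProduct_smul,
      dotProduct_comm (u n) b]
    simp only [smul_eq_mul, MulOpposite.smul_eq_mul_unop, MulOpposite.unop_op]
    ring
  · simp only [dotProduct, Matrix.mulVec_diagonal]
    exact Finset.sum_congr rfl fun j _ => by ring

theorem posDef_gramDiag {s : Finset ν} {w : ν → ℝ} {u : ν → ι → ℝ} {d : ι → ℝ}
    (hw : ∀ n, 0 ≤ w n) (hd : ∀ j, 0 < d j) : (gramDiag s w u d).PosDef := by
  refine Matrix.PosDef.of_dotProduct_mulVec_pos ?_ fun x hx => ?_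
  · rw [Matrix.IsHermitian, Matrix.conjTranspose_eq_transpose_of_trivial, transpose_gramDiag]
  · rw [star_trivial, dotProduct_gramDiag_mulVec]
    obtain ⟨j, hj⟩ := Function.ne_iff.1 hx
    refine add_pos_of_nonneg_of_pos (Finset.sum_nonneg fun n _ => mul_nonneg (hw n) (sq_nonneg _))
      (Finset.sum_pos' (fun j _ => mul_nonneg (hd j).le (sq_nonneg _)) ⟨j, Finset.mem_univ _, ?_⟩)
    exact mul_pos (hd j) (pow_pos (abs_pos.2 hj) 2 |>.trans_eq (sq_abs _))

/-- Cauchy–Schwarz inequality for the form of a positive definite matrix and its inverse. -/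
theorem sq_dotProduct_le {C : Matrix ι ι ℝ} (hC : C.PosDef) (b v : ι → ℝ) :
    (b ⬝ᵥ v) ^ 2 ≤ (b ⬝ᵥ C *ᵥ b) * (v ⬝ᵥ C⁻¹ *ᵥ v) := by
  have hu : IsUnit C.det := (Matrix.isUnit_iff_isUnit_det _).1 hC.isUnit
  set x := C⁻¹ *ᵥ v with hx
  have hCx : C *ᵥ x = v := by rw [hx, Matrix.mulVec_mulVec, Matrix.mul_nonsing_inv _ hu,
    Matrix.one_mulVec]
  have hT : Cᵀ = C := by
    have := hC.isHermitian; rwa [Matrix.IsHermitian,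
      Matrix.conjTranspose_eq_transpose_of_trivial] at this
  have hxb : x ⬝ᵥ C *ᵥ b = b ⬝ᵥ v := by
    rw [Matrix.dotProduct_mulVec, ← Matrix.mulVec_transpose, hT, hCx, dotProduct_comm]
  -- This is the form of `C` at `b - t x` with `C x = v`; being nonnegative for all `t`, it has
  -- nonpositive discriminant.
  have key : ∀ t : ℝ, 0 ≤ (b ⬝ᵥ C *ᵥ b) - 2 * t * (b ⬝ᵥ v) + t ^ 2 * (v ⬝ᵥ x) := fun t => by
    have h := hC.posSemidef.dotProduct_mulVec_nonneg (b - t • x)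
    rw [star_trivial] at h
    simp only [Matrix.mulVec_sub, Matrix.mulVec_smul, sub_dotProduct, dotProduct_sub,
      smul_dotProduct, dotProduct_smul, hCx, hxb, smul_eq_mul, dotProduct_comm x v] at h
    linarith
  have hd := discrim_le_zero (a := v ⬝ᵥ x) (b := -2 * (b ⬝ᵥ v)) (c := b ⬝ᵥ C *ᵥ b) fun t => by
    have := key t; linarith
  rw [discrim] at hd
  linarith

theorem gramDiagForm_eq (s : Finset ν) (w : ν → ℝ) (u : ν → ι → ℝ) (d : ι → ℝ) (b : ι → ℂ) :
    gramDiagForm s w u d b =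
      (fun j => (b j).re) ⬝ᵥ gramDiag s w u d *ᵥ (fun j => (b j).re) +
      (fun j => (b j).im) ⬝ᵥ gramDiag s w u d *ᵥ (fun j => (b j).im) := by
  have : ∀ z : ℂ, ‖z‖ ^ 2 = z.re ^ 2 + z.im ^ 2 := fun z => norm_sq_mk z.re z.im
  simp only [dotProduct_gramDiag_mulVec, gramDiagForm, norm_sq_sum_star_mul]
  simp only [this, mul_add, Finset.sum_add_distrib]
  ring

theorem norm_sq_le_gramDiagForm_mul {s : Finset ν} {w : ν → ℝ} {u : ν → ι → ℝ} {d : ι → ℝ}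
    (hw : ∀ n, 0 ≤ w n) (hd : ∀ j, 0 < d j) (b : ι → ℂ) (v : ι → ℝ) :
    ‖∑ j, star (b j) * (v j : ℂ)‖ ^ 2 ≤
      gramDiagForm s w u d b * (v ⬝ᵥ (gramDiag s w u d)⁻¹ *ᵥ v) := by
  have hC := posDef_gramDiag (s := s) (u := u) hw hd
  rw [norm_sq_sum_star_mul, gramDiagForm_eq, add_mul]
  exact add_le_add (sq_dotProduct_le hC _ v) (sq_dotProduct_le hC _ v)

end Quadratic

/-! ### Second moments of the decoder inputs -/

section Moments
variable {L K M : ℕ} {Ω : Type*} [MeasurableSpace Ω] {μ : Measure Ω}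
  {N : Network L K} {S : Signals L K M Ω}

theorem cvar_of_integral_eq_zero {X : Ω → ℂ} (h : ∫ ω, X ω ∂μ = 0) :
    cvar μ X = ∫ ω, ‖X ω‖ ^ 2 ∂μ := by
  simp [cvar, h]

theorem integral_norm_sq_sum_of_orthogonal {ι : Type*} [DecidableEq ι] (s : Finset ι) (c : ι → ℂ)
    {f : ι → Ω → ℂ} {v : ι → ℝ} (hf : ∀ i ∈ s, MemLp (f i) 2 μ)
    (h : ∀ i i', ∫ ω, f i ω * star (f i' ω) ∂μ = if i = i' then (v i : ℂ) else 0) :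
    ∫ ω, ‖∑ i ∈ s, c i * f i ω‖ ^ 2 ∂μ = ∑ i ∈ s, v i * ‖c i‖ ^ 2 := by
  apply Complex.ofReal_injective
  rw [integral_norm_sq_eq, integral_sum_mul_star_sum _ _ _ _ hf hf]
  push_cast
  refine Finset.sum_congr rfl fun i hi => ?_
  simp only [h, mul_ite, mul_zero, Finset.sum_ite_eq, hi, if_true]
  rw [RCLike.star_def, Complex.mul_conj, Complex.normSq_eq_norm_sq]
  push_cast; ring

/-- The sum over `{l}` gives the useful signal the same shape as the pilot contamination, so
`integral_norm_sq_sum_symbol` yields the power of both. -/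
theorem usefulSignal_eq (k : Fin K) (l : Fin L) (a : N.nbhd l → ℂ) (ω : Ω) :
    usefulSignal N S μ k l a ω = ∑ n ∈ {l},
      (∑ j, star (a j) * meanGain N S μ j k n * (√(N.q k n) : ℂ)) * symbol S (some (k, n)) ω := by
  simp only [usefulSignal, Finset.sum_singleton, Finset.sum_mul, symbol]

theorem pilotContamination_eq (k : Fin K) (l : Fin L) (a : N.nbhd l → ℂ) (ω : Ω) :
    pilotContamination N S μ k l a ω = ∑ n ∈ Finset.univ.erase l,
      (∑ j, star (a j) * meanGain N S μ j k n * (√(N.q k n) : ℂ)) * symbol S (some (k, n)) ω := by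
  simp only [pilotContamination, Finset.sum_mul, symbol, Finset.mul_sum]
  rw [Finset.sum_comm]
  exact Finset.sum_congr rfl fun n _ => Finset.sum_congr rfl fun j _ => by ring

variable [IsProbabilityMeasure μ]

theorem memLp_sTilde (hS : S.IsModel μ) (hΦ : N.Φ * N.Φᴴ = 1)
    (hβ : ∀ j m n, 0 < N.β j m n) (hp : ∀ m n, 0 ≤ N.p m n) (k : Fin K) (j : Fin L) :
    MemLp (sTilde N S μ k j) 2 μ := by
  rw [funext (sTilde_eq hS hΦ hβ hp k j)]
  exact (memLp_finset_sum_const_mul _ _ fun _ _ => memLp_symbol hS _).add (memLp_localNoise hS k j)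

theorem memLp_usefulSignal (hS : S.IsModel μ) (k : Fin K) (l : Fin L) (a : N.nbhd l → ℂ) :
    MemLp (usefulSignal N S μ k l a) 2 μ := by
  rw [funext (usefulSignal_eq k l a)]
  exact memLp_finset_sum_const_mul _ _ fun _ _ => memLp_symbol hS _

theorem memLp_pilotContamination (hS : S.IsModel μ) (k : Fin K) (l : Fin L) (a : N.nbhd l → ℂ) :
    MemLp (pilotContamination N S μ k l a) 2 μ := by
  rw [funext (pilotContamination_eq k l a)]
  exact memLp_finset_sum_const_mul _ _ fun _ _ => memLp_symbol hS _

theorem memLp_interferenceNoise (hS : S.IsModel μ) (hΦ : N.Φ * N.Φᴴ = 1)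
    (hβ : ∀ j m n, 0 < N.β j m n) (hp : ∀ m n, 0 ≤ N.p m n) (k : Fin K) (l : Fin L)
    (a : N.nbhd l → ℂ) : MemLp (interferenceNoise N S μ k l a) 2 μ := by
  rw [funext (interferenceNoise_eq hS hΦ hβ hp k l a)]
  exact memLp_finset_sum_const_mul _ (fun j => star (a j)) fun j _ => memLp_localNoise hS k j

/-- Power of a combination of pilot sharing data symbols, weighted by the mean gains. -/
theorem integral_norm_sq_sum_symbol (hS : S.IsModel μ) (hΦ : N.Φ * N.Φᴴ = 1)
    (hβ : ∀ j m n, 0 < N.β j m n) (hp : ∀ m n, 0 ≤ N.p m n) (hq : ∀ m n, 0 ≤ N.q m n)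
    (k : Fin K) (l : Fin L) (a : N.nbhd l → ℂ) (s : Finset (Fin L)) :
    ∫ ω, ‖∑ n ∈ s, (∑ j, star (a j) * meanGain N S μ j k n * (√(N.q k n) : ℂ)) *
        symbol S (some (k, n)) ω‖ ^ 2 ∂μ =
      M * ∑ n ∈ s, (N.p k n * N.q k n * M) *
        ‖∑ j : N.nbhd l, star ((eta N k j : ℂ) * a j) * (betaVec N l k n j : ℂ)‖ ^ 2 := by
  rw [integral_norm_sq_sum_of_orthogonal (v := fun _ => 1) s _ (fun n _ => memLp_symbol hS _)
    (fun n n' => by rw [integral_symbol_mul_star hS]; simp), Finset.mul_sum]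
  refine Finset.sum_congr rfl fun n _ => ?_
  have : ∑ j : N.nbhd l, star (a j) * meanGain N S μ j k n * (√(N.q k n) : ℂ) =
      ((M * √(N.p k n) * √(N.q k n) : ℝ) : ℂ) *
        ∑ j : N.nbhd l, star ((eta N k j : ℂ) * a j) * (betaVec N l k n j : ℂ) := by
    rw [Finset.mul_sum]
    refine Finset.sum_congr rfl fun j _ => ?_
    rw [meanGain_eq hS hΦ hβ hp, star_mul', RCLike.star_def, Complex.conj_ofReal, betaVec]
    push_cast; ring
  rw [this, norm_mul, Complex.norm_real, mul_pow, Real.norm_eq_abs, sq_abs, mul_pow, mul_pow,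
    Real.sq_sqrt (hp k n), Real.sq_sqrt (hq k n)]
  ring

theorem cvar_interferenceNoise (hS : S.IsModel μ) (hΦ : N.Φ * N.Φᴴ = 1)
    (hβ : ∀ j m n, 0 < N.β j m n) (hp : ∀ m n, 0 ≤ N.p m n) (hq : ∀ m n, 0 ≤ N.q m n)
    (k : Fin K) (l : Fin L) (a : N.nbhd l → ℂ) :
    cvar μ (interferenceNoise N S μ k l a) =
      M * ∑ j : N.nbhd l, lam N j k * ‖(eta N k j : ℂ) * a j‖ ^ 2 := by
  have h0 : ∫ ω, interferenceNoise N S μ k l a ω ∂μ = 0 := by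
    simp only [interferenceNoise_eq hS hΦ hβ hp]
    rw [integral_finsetSum _ fun (j : N.nbhd l) _ =>
      ((memLp_localNoise hS k j).integrable (by norm_num)).const_mul _]
    simp [integral_const_mul, integral_localNoise hS]
  rw [cvar_of_integral_eq_zero h0]
  simp only [interferenceNoise_eq hS hΦ hβ hp]
  rw [integral_norm_sq_sum_of_orthogonal Finset.univ (fun j : N.nbhd l => star (a j))
    (v := fun j : N.nbhd l => M * eta N k j ^ 2 * lam N j k) (fun j _ => memLp_localNoise hS k j)
    (fun j j' => by
      rw [integral_localNoise_mul_star hS hΦ hβ hp hq]; simp only [Subtype.ext_iff]),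
    Finset.mul_sum]
  refine Finset.sum_congr rfl fun j _ => ?_
  rw [norm_star, norm_mul, mul_pow, Complex.norm_real, Real.norm_eq_abs, sq_abs]
  ring

/-- In the variable `b = D a` numerator and denominator share a factor `M`, which cancels as `M >
0`. What remains is a generalised Rayleigh quotient for `C` with a rank one numerator. -/
theorem sinrDec_eq (hM : 0 < M) (hS : S.IsModel μ) (hΦ : N.Φ * N.Φᴴ = 1)
    (hβ : ∀ j m n, 0 < N.β j m n) (hp : ∀ m n, 0 ≤ N.p m n) (hq : ∀ m n, 0 ≤ N.q m n)
    (k : Fin K) (l : Fin L) (a : N.nbhd l → ℂ) :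
    sinrDec N S μ k l a = N.p k l * N.q k l * M *
      ‖∑ j : N.nbhd l, star ((eta N k j : ℂ) * a j) * (betaVec N l k l j : ℂ)‖ ^ 2 /
        gramDiagForm (Finset.univ.erase l) (fun n => N.p k n * N.q k n * (M : ℝ)) (betaVec N l k)
          (fun j : N.nbhd l => lam N j k) (fun j : N.nbhd l => (eta N k j : ℂ) * a j) := by
  have h0 : ∫ ω, pilotContamination N S μ k l a ω ∂μ = 0 := by
    simp only [pilotContamination_eq]
    rw [integral_finsetSum _ fun n _ =>
      ((memLp_symbol hS (some (k, n))).integrable (by norm_num)).const_mul _]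
    simp [integral_const_mul, symbol, hS.mean_s]
  rw [sinrDec, cvar_of_integral_eq_zero h0, cvar_interferenceNoise hS hΦ hβ hp hq]
  simp only [usefulSignal_eq, pilotContamination_eq]
  rw [integral_norm_sq_sum_symbol hS hΦ hβ hp hq, integral_norm_sq_sum_symbol hS hΦ hβ hp hq,
    ← mul_add, Finset.sum_singleton, mul_div_mul_left _ _ (by positivity)]
  rfl

theorem integral_sTilde_mul_star_symbol (hS : S.IsModel μ) (hΦ : N.Φ * N.Φᴴ = 1)
    (hβ : ∀ j m n, 0 < N.β j m n) (hp : ∀ m n, 0 ≤ N.p m n) (k : Fin K) (j n : Fin L) :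
    ∫ ω, sTilde N S μ k j ω * star (symbol S (some (k, n)) ω) ∂μ =
      ((M * eta N k j * N.β j k n * √(N.q k n) * √(N.p k n) : ℝ) : ℂ) := by
  simp only [sTilde_eq hS hΦ hβ hp, add_mul, Finset.sum_mul, mul_assoc (_ * _ : ℂ)]
  have hi : ∀ n', Integrable (fun ω => (meanGain N S μ j k n' * (√(N.q k n') : ℂ)) *
      (symbol S (some (k, n')) ω * star (symbol S (some (k, n)) ω))) μ := fun n' =>
    (integrable_mul_star (memLp_symbol hS _) (memLp_symbol hS _)).const_mul _
  rw [integral_add (integrable_finsetSum _ fun n' _ => hi n')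
    (integrable_mul_star (memLp_localNoise hS k j) (memLp_symbol hS _)),
    integral_finsetSum _ fun n' _ => hi n', integral_localNoise_mul_star_symbol hS]
  simp only [integral_const_mul, integral_symbol_mul_star hS, meanGain_eq hS hΦ hβ hp]
  simp
  ring

theorem integral_sTilde_mul_star (hS : S.IsModel μ) (hΦ : N.Φ * N.Φᴴ = 1)
    (hβ : ∀ j m n, 0 < N.β j m n) (hp : ∀ m n, 0 ≤ N.p m n) (hq : ∀ m n, 0 ≤ N.q m n)
    (k : Fin K) (j j' : Fin L) :
    ∫ ω, sTilde N S μ k j ω * star (sTilde N S μ k j' ω) ∂μ =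
      ((M * (eta N k j * eta N k j' * (∑ n, (N.p k n * N.q k n * M) * (N.β j k n * N.β j' k n) +
        if j = j' then lam N j k else 0)) : ℝ) : ℂ) := by
  -- Expanding the second factor first lets the known correlations of `sTilde` with the symbols be
  -- reused; the correlations of symbols with noise vanish.
  have h1 : ∀ ω, sTilde N S μ k j ω * star (sTilde N S μ k j' ω) =
      ∑ n, star (meanGain N S μ j' k n * (√(N.q k n) : ℂ)) *
        (sTilde N S μ k j ω * star (symbol S (some (k, n)) ω)) +
      ∑ n, (meanGain N S μ j k n * (√(N.q k n) : ℂ)) *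
        star (localNoise N S k j' ω * star (symbol S (some (k, n)) ω)) +
      localNoise N S k j ω * star (localNoise N S k j' ω) := fun ω => by
    rw [sTilde_eq hS hΦ hβ hp k j' ω, star_add, mul_add, star_sum, Finset.mul_sum, add_assoc]
    congr 1
    · exact Finset.sum_congr rfl fun n _ => by rw [star_mul']; ring
    · rw [sTilde_eq hS hΦ hβ hp k j ω, add_mul, Finset.sum_mul]
      congr 1
      exact Finset.sum_congr rfl fun n _ => by rw [star_mul', star_star]; ring
  have i1 : ∀ n, Integrable (fun ω => star (meanGain N S μ j' k n * (√(N.q k n) : ℂ)) *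
        (sTilde N S μ k j ω * star (symbol S (some (k, n)) ω))) μ := fun n =>
    (integrable_mul_star (memLp_sTilde hS hΦ hβ hp k j) (memLp_symbol hS _)).const_mul _
  have i2' : ∀ n, Integrable (fun ω => localNoise N S k j' ω * star (symbol S (some (k, n)) ω)) μ :=
    fun n => integrable_mul_star (memLp_localNoise hS k j') (memLp_symbol hS _)
  have i2'' : ∀ n, Integrable
      (fun ω => star (localNoise N S k j' ω * star (symbol S (some (k, n)) ω))) μ := fun n =>
    (Complex.conjCLE.toContinuousLinearMap).integrable_comp (i2' n)
  have i2 : ∀ n, Integrable (fun ω => (meanGain N S μ j k n * (√(N.q k n) : ℂ)) *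
        star (localNoise N S k j' ω * star (symbol S (some (k, n)) ω))) μ := fun n =>
    (i2'' n).const_mul _
  have z : ∀ n, ∫ ω, star (localNoise N S k j' ω * star (symbol S (some (k, n)) ω)) ∂μ = 0 :=
    fun n => (integral_conj (𝕜 := ℂ)).trans
      (by rw [integral_localNoise_mul_star_symbol hS, map_zero])
  simp only [h1]
  have i12 := (integrable_finsetSum Finset.univ fun n _ => i1 n).fun_add
    (integrable_finsetSum Finset.univ fun n _ => i2 n)
  rw [integral_add i12
      (integrable_mul_star (memLp_localNoise hS k j) (memLp_localNoise hS k j')),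
    integral_add (integrable_finsetSum _ fun n _ => i1 n) (integrable_finsetSum _ fun n _ => i2 n),
    integral_finsetSum _ fun n _ => i1 n, integral_finsetSum _ fun n _ => i2 n]
  simp only [integral_const_mul, z, mul_zero, Finset.sum_const_zero, add_zero,
    integral_localNoise_mul_star hS hΦ hβ hp hq, integral_sTilde_mul_star_symbol hS hΦ hβ hp,
    meanGain_eq hS hΦ hβ hp]
  rw [mul_add, mul_add, Complex.ofReal_add, Finset.mul_sum, Finset.mul_sum, Complex.ofReal_sum]
  congr 1
  · refine Finset.sum_congr rfl fun n _ => ?_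
    rw [star_mul', RCLike.star_def, Complex.conj_ofReal, Complex.conj_ofReal, ← Complex.ofReal_mul,
      ← Complex.ofReal_mul]
    congr 1
    calc _ = M * M * eta N k j * eta N k j' * N.β j k n * N.β j' k n *
        (√(N.p k n) * √(N.p k n)) * (√(N.q k n) * √(N.q k n)) := by ring
      _ = _ := by rw [Real.mul_self_sqrt (hp k n), Real.mul_self_sqrt (hq k n)]; ring
  · split_ifs with h
    · subst h; push_cast; ring
    · simp

end Moments

/-! ### The MMSE vector -/

section MMSE
variable {L K M : ℕ} {N : Network L K}

theorem eta_pos (hβ : ∀ j m n, 0 < N.β j m n) (hp : ∀ m n, 0 ≤ N.p m n) {k : Fin K} {j : Fin L}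
    (h : 0 < N.p k j) : 0 < eta N k j :=
  div_pos (mul_pos (hβ _ _ _) (Real.sqrt_pos.2 h)) (rPower_pos N hβ hp k j)

theorem lam_pos (hβ : ∀ j m n, 0 < N.β j m n) (hp : ∀ m n, 0 ≤ N.p m n)
    (hq : ∀ m n, 0 ≤ N.q m n) (j : Fin L) (k : Fin K) : 0 < lam N j k :=
  mul_pos (rPower_pos N hβ hp k j) (add_pos_of_pos_of_nonneg one_pos
    (Finset.sum_nonneg fun _ _ => Finset.sum_nonneg fun _ _ => mul_nonneg (hβ _ _ _).le (hq _ _)))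

theorem Cmat_eq (M : ℕ) (N : Network L K) (k : Fin K) (l : Fin L) : Cmat M N k l =
    gramDiag (Finset.univ.erase l) (fun n => N.p k n * N.q k n * (M : ℝ)) (betaVec N l k)
      (fun j : N.nbhd l => lam N j k) := rfl

/-- `C_{kl}` with the summand of the cell `l` included. -/
def fullCmat (M : ℕ) (N : Network L K) (k : Fin K) (l : Fin L) :
    Matrix (N.nbhd l) (N.nbhd l) ℝ :=
  gramDiag Finset.univ (fun n => N.p k n * N.q k n * (M : ℝ)) (betaVec N l k)
    (fun j : N.nbhd l => lam N j k)

theorem fullCmat_eq (M : ℕ) (N : Network L K) (k : Fin K) (l : Fin L) : fullCmat M N k l =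
    (N.p k l * N.q k l * (M : ℝ)) • Matrix.vecMulVec (betaVec N l k l) (betaVec N l k l)
      + Cmat M N k l := by
  rw [fullCmat, gramDiag, ← Finset.add_sum_erase _ _ (Finset.mem_univ l), add_assoc]
  rfl

variable {Ω : Type*} [MeasurableSpace Ω] {μ : Measure Ω} [IsProbabilityMeasure μ]
  {S : Signals L K M Ω}

/-- Here the sum over `n` includes `l`, as the wanted symbol also contributes to the covariance;
hence `fullCmat` in place of `Cmat`. -/
theorem covMat_eq (hS : S.IsModel μ) (hΦ : N.Φ * N.Φᴴ = 1)
    (hβ : ∀ j m n, 0 < N.β j m n) (hp : ∀ m n, 0 ≤ N.p m n) (hq : ∀ m n, 0 ≤ N.q m n)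
    (k : Fin K) (l : Fin L) : covMat N S μ k l =
      ((M : ℝ) • (Dmat N k l * fullCmat M N k l * Dmat N k l)).map Complex.ofRealHom := by
  ext j j'
  simp only [covMat, corr, Matrix.of_apply, sTildeVec, integral_sTilde_mul_star hS hΦ hβ hp hq,
    Matrix.map_apply, Matrix.smul_apply, Dmat, Matrix.mul_diagonal, Matrix.diagonal_mul, fullCmat,
    gramDiag, Matrix.add_apply, Matrix.sum_apply, Matrix.vecMulVec_apply, betaVec, smul_eq_mul,
    Matrix.diagonal_apply, Complex.ofRealHom_eq_coe, Subtype.ext_iff]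
  congr 1
  ring

theorem map_ofReal_mulVec {ι : Type*} [Fintype ι] (A : Matrix ι ι ℝ) (v : ι → ℝ) :
    A.map Complex.ofRealHom *ᵥ (fun j => (v j : ℂ)) = fun j => ((A *ᵥ v) j : ℂ) := by
  funext j
  simp [Matrix.mulVec, dotProduct]

theorem crossVec_eq (hS : S.IsModel μ) (hΦ : N.Φ * N.Φᴴ = 1)
    (hβ : ∀ j m n, 0 < N.β j m n) (hp : ∀ m n, 0 ≤ N.p m n) (k : Fin K) (l : Fin L)
    (j : N.nbhd l) : crossVec N S μ k l j =
      (((M : ℝ) * eta N k j * N.β j k l * √(N.q k l) * √(N.p k l) : ℝ) : ℂ) :=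
  integral_sTilde_mul_star_symbol hS hΦ hβ hp k j l

end MMSE

end LSFD

end

/-! ### Optimality of the MMSE decoding vector -/

open LSFD in
theorem theorem6 {L K M : ℕ} (hM : 0 < M) {Ω : Type*} [MeasurableSpace Ω] (μ : Measure Ω)
    [IsProbabilityMeasure μ] (N : LSFD.Network L K) (S : LSFD.Signals L K M Ω)
    (hS : S.IsModel μ) (hΦ : N.Φ * N.Φᴴ = 1)
    (hβ : ∀ j m n, 0 < N.β j m n) (hp : ∀ m n, 0 ≤ N.p m n) (hq : ∀ m n, 0 ≤ N.q m n)
    (k : Fin K) (l : Fin L) (hl : l ∈ N.nbhd l)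
    (hpk : ∀ j ∈ N.nbhd l, 0 < N.p k j) (hqkl : 0 < N.q k l) :
    -- the second moments and the inverse matrices exist
    (∀ j : N.nbhd l, MemLp (LSFD.sTilde N S μ k j) 2 μ) ∧
    (∀ a : N.nbhd l → ℂ, MemLp (LSFD.usefulSignal N S μ k l a) 2 μ ∧
      MemLp (LSFD.pilotContamination N S μ k l a) 2 μ ∧
      MemLp (LSFD.interferenceNoise N S μ k l a) 2 μ) ∧
    IsUnit (LSFD.covMat N S μ k l).det ∧ IsUnit (LSFD.Dmat N k l).det ∧
    IsUnit (LSFD.Cmat M N k l).det ∧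
    -- the cross-correlation is given by quantities available to base station `l`
    (∀ j : N.nbhd l, LSFD.crossVec N S μ k l j =
      (((M : ℝ) * LSFD.eta N k j * N.β j k l * √(N.q k l) * √(N.p k l) : ℝ) : ℂ)) ∧
    -- the MMSE vector is a multiple of the optimal vector
    (∃ c : ℝ, 0 < c ∧ ∀ j, LSFD.aMMSE N S μ k l j =
      ((c * ((LSFD.Dmat N k l)⁻¹ *ᵥ LSFD.aHatOpt M N k l) j : ℝ) : ℂ)) ∧
    -- it is optimal, with the stated SINR
    LSFD.aMMSE N S μ k l ≠ 0 ∧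
    (∀ a : N.nbhd l → ℂ, a ≠ 0 →
      LSFD.sinrDec N S μ k l a ≤ LSFD.sinrDec N S μ k l (LSFD.aMMSE N S μ k l)) ∧
    LSFD.sinrDec N S μ k l (LSFD.aMMSE N S μ k l) = LSFD.sinrOpt M N k l := by
  have hM' : (0 : ℝ) < M := Nat.cast_pos.2 hM
  have hη : ∀ j : N.nbhd l, 0 < eta N k j := fun j => eta_pos hβ hp (hpk j j.2)
  have hw : ∀ n, 0 ≤ N.p k n * N.q k n * (M : ℝ) := fun n =>
    mul_nonneg (mul_nonneg (hp _ _) (hq _ _)) hM'.le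
  have hd : ∀ j : N.nbhd l, 0 < lam N j k := fun j => lam_pos hβ hp hq j k
  have hwl : 0 < N.p k l * N.q k l * (M : ℝ) := mul_pos (mul_pos (hpk l hl) hqkl) hM'
  have hC : (Cmat M N k l).PosDef := posDef_gramDiag hw hd
  have hCu : IsUnit (Cmat M N k l).det := (Matrix.isUnit_iff_isUnit_det _).1 hC.isUnit
  have hFu : IsUnit (fullCmat M N k l).det :=
    (Matrix.isUnit_iff_isUnit_det _).1 (posDef_gramDiag hw hd).isUnit
  have hDu : IsUnit (Dmat N k l).det := by
    rw [Dmat, Matrix.det_diagonal, isUnit_iff_ne_zero]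
    exact Finset.prod_ne_zero_iff.2 fun j _ => (hη j).ne'
  have hcov := covMat_eq hS hΦ hβ hp hq k l
  have hcovu : IsUnit (covMat N S μ k l).det := by
    rw [hcov, ← RingHom.mapMatrix_apply, ← RingHom.map_det]
    refine IsUnit.map _ ?_
    rw [Matrix.det_smul, Matrix.det_mul, Matrix.det_mul]
    exact ((isUnit_iff_ne_zero.2 hM'.ne').pow _).mul ((hDu.mul hFu).mul hDu)
  have hcross := crossVec_eq hS hΦ hβ hp k l
  set v := betaVec N l k l with hv
  set x := aHatOpt M N k l with hx
  have hCx : Cmat M N k l *ᵥ x = v := by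
    rw [hx, aHatOpt, Matrix.mulVec_mulVec, Matrix.mul_nonsing_inv _ hCu, Matrix.one_mulVec]
  have hv0 : v ≠ 0 := Function.ne_iff.2 ⟨⟨l, hl⟩, (hβ l k l).ne'⟩
  have hx0 : x ≠ 0 := fun h => hv0 (by rw [← hCx, h, Matrix.mulVec_zero])
  set θ := v ⬝ᵥ x with hθ
  have hθpos : 0 < θ := by
    have := hC.dotProduct_mulVec_pos hx0
    rwa [star_trivial, hCx, dotProduct_comm] at this
  -- The denominator is the Sherman–Morrison factor by which `C + w vvᵀ` multiplies `v` when applied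
  -- to `C⁻¹v`, with `w = p_{kl} q_{kl} M`; the numerator comes from the cross-correlation.
  set c : ℝ := √(N.q k l) * √(N.p k l) / (1 + N.p k l * N.q k l * M * θ) with hc
  have hden : 0 < 1 + N.p k l * N.q k l * M * θ := add_pos one_pos (mul_pos hwl hθpos)
  have hcpos : 0 < c :=
    div_pos (mul_pos (Real.sqrt_pos.2 hqkl) (Real.sqrt_pos.2 (hpk l hl))) hden
  have hDx : ∀ j, ((Dmat N k l)⁻¹ *ᵥ x) j = x j / eta N k j := fun j => by
    have h : Dmat N k l *ᵥ ((Dmat N k l)⁻¹ *ᵥ x) = x := by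
      rw [Matrix.mulVec_mulVec, Matrix.mul_nonsing_inv _ hDu, Matrix.one_mulVec]
    have h' := congrFun h j
    rw [Dmat, Matrix.mulVec_diagonal, ← Dmat] at h'
    rw [eq_div_iff (hη j).ne', mul_comm, h']
  have hmmse : ∀ j, aMMSE N S μ k l j = ((c * ((Dmat N k l)⁻¹ *ᵥ x) j : ℝ) : ℂ) := by
    -- It suffices to check that the candidate solves the normal equations, since the covariance
    -- matrix is invertible.
    have hmul : covMat N S μ k l *ᵥ (fun j => ((c * ((Dmat N k l)⁻¹ *ᵥ x) j : ℝ) : ℂ)) =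
        crossVec N S μ k l := by
      have e1 : (fun j => ((c * ((Dmat N k l)⁻¹ *ᵥ x) j : ℝ) : ℂ)) =
          fun j => (((c • ((Dmat N k l)⁻¹ *ᵥ x)) j : ℝ) : ℂ) := rfl
      rw [hcov, e1, map_ofReal_mulVec]
      funext j
      rw [hcross]
      congr 1
      have e2 : ((M : ℝ) • (Dmat N k l * fullCmat M N k l * Dmat N k l)) *ᵥ
          (c • ((Dmat N k l)⁻¹ *ᵥ x)) =
          ((M : ℝ) * c * (1 + N.p k l * N.q k l * M * θ)) • (Dmat N k l *ᵥ v) := by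
        have e3 : fullCmat M N k l *ᵥ x = (1 + N.p k l * N.q k l * M * θ) • v := by
          rw [fullCmat_eq, Matrix.add_mulVec, hCx, Matrix.smul_mulVec, Matrix.vecMulVec_mulVec,
            ← hv, ← hθ, op_smul_eq_smul, smul_smul, add_smul, one_smul, add_comm]
        rw [Matrix.mulVec_smul, Matrix.smul_mulVec, ← Matrix.mulVec_mulVec,
          Matrix.mulVec_mulVec x, Matrix.mul_nonsing_inv _ hDu, Matrix.one_mulVec,
          ← Matrix.mulVec_mulVec, e3, Matrix.mulVec_smul, smul_smul, smul_smul]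
        congr 1
        ring
      rw [e2, Pi.smul_apply, Dmat, Matrix.mulVec_diagonal, smul_eq_mul, mul_assoc (M : ℝ) c, hc,
        div_mul_cancel₀ _ hden.ne', hv, betaVec]
      ring
    intro j
    rw [aMMSE, ← hmul, Matrix.mulVec_mulVec, Matrix.nonsing_inv_mul _ hcovu, Matrix.one_mulVec]
  -- In the variable `b = D a` the MMSE vector is the real vector `c C⁻¹v`, the equality case of
  -- Cauchy–Schwarz. The imaginary parts vanish and `c` cancels from the quotient.
  have hscaled : (fun j : N.nbhd l => (eta N k j : ℂ) * aMMSE N S μ k l j) =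
      fun j => ((c * x j : ℝ) : ℂ) := by
    funext j
    rw [hmmse, hDx, ← Complex.ofReal_mul]
    congr 1
    have := (hη j).ne'
    field_simp
  have hopt : sinrDec N S μ k l (aMMSE N S μ k l) = N.p k l * N.q k l * (M : ℝ) * θ := by
    have h1 : (fun j => c * x j) ⬝ᵥ v = c * θ := by
      rw [hθ, dotProduct_comm v x, ← smul_eq_mul, ← smul_dotProduct]; rfl
    have h2 : (fun j => c * x j) ⬝ᵥ Cmat M N k l *ᵥ (fun j => c * x j) = c ^ 2 * θ := by
      have : (fun j => c * x j) = c • x := rfl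
      rw [this, Matrix.mulVec_smul, hCx, smul_dotProduct, dotProduct_smul, dotProduct_comm x v]
      simp only [smul_eq_mul]; ring
    rw [sinrDec_eq hM hS hΦ hβ hp hq, hscaled, gramDiagForm_eq, ← Cmat_eq,
      norm_sq_sum_star_mul (fun j : N.nbhd l => (eta N k j : ℂ) * aMMSE N S μ k l j) v]
    simp only [congrFun hscaled]
    simp only [Complex.ofReal_re, Complex.ofReal_im, h1, h2]
    have h0 : (fun _ : N.nbhd l => (0 : ℝ)) = 0 := rfl
    rw [h0, zero_dotProduct, zero_dotProduct]
    field_simp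
    ring
  refine ⟨fun j => memLp_sTilde hS hΦ hβ hp k j, fun a => ⟨memLp_usefulSignal hS k l a,
    memLp_pilotContamination hS k l a, memLp_interferenceNoise hS hΦ hβ hp k l a⟩, hcovu, hDu, hCu,
    hcross, ⟨c, hcpos, hmmse⟩, fun h => ?_, fun a ha => ?_, hopt⟩
  · refine hx0 (funext fun j => ?_)
    have h' := congrFun hscaled j
    simp only [h, Pi.zero_apply, mul_zero] at h'
    have h'' : c * x j = 0 := by exact_mod_cast h'.symm
    exact (mul_eq_zero.1 h'').resolve_left hcpos.ne'
  -- Positivity of all `η` keeps `D a` nonzero, so the denominator of the SINR is positive.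
  · have hb : (fun j : N.nbhd l => (eta N k j : ℂ) * a j) ≠ 0 := by
      obtain ⟨j, hj⟩ := Function.ne_iff.1 ha
      exact Function.ne_iff.2 ⟨j, mul_ne_zero (Complex.ofReal_ne_zero.2 (hη j).ne') hj⟩
    rw [hopt, sinrDec_eq hM hS hΦ hβ hp hq, div_le_iff₀ (gramDiagForm_pos hw hd hb),
      mul_assoc _ θ, mul_comm θ]
    exact mul_le_mul_of_nonneg_left (norm_sq_le_gramDiagForm_mul hw hd _ v) hwl.le
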